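/- Let $E=(E^0,E^1,r,s)$ be a row-finite directed graph, i.e. every vertex emits only finitely many edges, and let $K$ be a field. Write $v\ge w$ if there is a path (possibly of length $0$) from $v$ to $w$. A set $H\subseteq E^0$ is hereditary if $v\ge w$ and $v\in H$ imply $w\in H$; it is saturated if every $v$ with $s^{-1}(v)\neq\emptyset$ and $r(s^{-1}(v))\subseteq H$ lies in $H$. Let $\mathcal H$ be the set of saturated hereditary subsets of $E^0$, ordered by inclusion. Let $M_E$ be the abelian monoid with generators $[v]$ $(v\in E^0)$ and relations $[v]=\sum_{s(e)=v}[r(e)]$ for every $v$ that emits edges. Let $\mathcal L(M_E)$ be the set of its order-ideals, i.e. the submonoids $I$ such that $x+y\in I$ implies $x,y\in I$, ordered by inclusion. Let $L_K(E)$ be the (not necessarily unital) $K$-algebra with generators $p_v$ $(v\in E^0)$, $x_e,y_e$ $(e\in E^1)$ and relations $p_vp_{v'}=\delta_{v,v'}p_v$; $p_{s(e)}x_e=x_ep_{r(e)}=x_e$; $p_{r(e)}y_e=y_ep_{s(e)}=y_e$; $y_ex_{e'}=\delta_{e,e'}p_{r(e)}$; and $p_v=\sum_{s(e)=v}x_ey_e$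 for every $v$ that emits edges. For $n\in\mathbb Z$ let $L_K(E)_n$ be the $K$-span of the products of generators of total degree $n$, where $\deg p_v=0$, $\deg x_e=1$, $\deg y_e=-1$. A two-sided ideal $I$ is graded if $I=\bigoplus_{n\in\mathbb Z}(I\cap L_K(E)_n)$. Let $\mathcal L_{\mathrm{gr}}(L_K(E))$ be the set of graded ideals, ordered by inclusion. Then there are order-isomorphisms $$\varphi:\mathcal H\to\mathcal L(M_E),\qquad \theta:\mathcal L(M_E)\to\mathcal L_{\mathrm{gr}}(L_K(E)),$$ where $\varphi(H)$ is the smallest order-ideal of $M_E$ containing $\{[v] : v\in H\}$, $\varphi^{-1}(I)=\{v\in E^0 : [v]\in I\}$, and $\theta(I)$ is the two-sided ideal of $L_K(E)$ generated by $\{p_v : [v]\in I\}$. Moreover, the algebra $L_K(E)_0$ is ultramatricial, i.e. it is a direct limit, over a nonempty directed set and with not necessarily unital connecting homomorphisms, of matricial $K$-algebras (finite direct products of full matrix algebras over $K$); and every graded ideal of $L_K(E)$ is generated, as a two-sided ideal, by the idempotents it contains. -/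

import Mathlib

universe u v w

/-- A row-finite directed graph: vertex set, edge set, source and range maps,
such that each vertex emits only finitely many edges. -/
structure RowFiniteGraph where
  Vert : Type u
  Edge : Type v
  src : Edge → Vert
  rng : Edge → Vert
  finite_emit : ∀ a : Vert, {e : Edge | src e = a}.Finite

namespace RowFiniteGraph

/-- The finite set `s⁻¹(a)` of edges emitted by `a`. -/
noncomputable def emit (E : RowFiniteGraph.{u, v}) (a : E.Vert) : Finset E.Edge :=
  (E.finite_emit a).toFinset

/-! ### Saturated hereditary subsets -/

/-- `a ≥ b`: there is a finite path (possibly of length zero) from `a` to `b`. -/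
def Reaches (E : RowFiniteGraph.{u, v}) : E.Vert → E.Vert → Prop :=
  Relation.ReflTransGen fun a b => ∃ e : E.Edge, E.src e = a ∧ E.rng e = b

def IsHereditary (E : RowFiniteGraph.{u, v}) (H : Set E.Vert) : Prop :=
  ∀ a b : E.Vert, E.Reaches a b → a ∈ H → b ∈ H

def IsSaturated (E : RowFiniteGraph.{u, v}) (H : Set E.Vert) : Prop :=
  ∀ a : E.Vert, (∃ e : E.Edge, E.src e = a) →
    (∀ e : E.Edge, E.src e = a → E.rng e ∈ H) → a ∈ H

/-- The saturated hereditary sets of vertices, ordered by inclusion. -/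
abbrev SatHered (E : RowFiniteGraph.{u, v}) : Type u :=
  {H : Set E.Vert // E.IsHereditary H ∧ E.IsSaturated H}

/-! ### The graph monoid -/

/-- The defining relations `a = ∑_{s(e) = a} r(e)` of the graph monoid, for the vertices `a` that
emit edges, in the free abelian monoid on the vertices. -/
def MonoidRel (E : RowFiniteGraph.{u, v}) (x y : E.Vert →₀ ℕ) : Prop :=
  ∃ a : E.Vert, (∃ e : E.Edge, E.src e = a) ∧
    x = Finsupp.single a 1 ∧ y = ∑ e ∈ E.emit a, Finsupp.single (E.rng e) 1

/-- The graph monoid `M_E`. -/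
abbrev GraphMonoid (E : RowFiniteGraph.{u, v}) : Type u :=
  (addConGen E.MonoidRel).Quotient

/-- The class in `M_E` of a vertex. -/
noncomputable def vertClass (E : RowFiniteGraph.{u, v}) (a : E.Vert) : E.GraphMonoid :=
  ((Finsupp.single a 1 : E.Vert →₀ ℕ) : (addConGen E.MonoidRel).Quotient)

end RowFiniteGraph

/-- The order-ideals of an abelian monoid, ordered by inclusion: submonoids `I` such that
`x + y ∈ I` implies `x ∈ I` and `y ∈ I`. -/
abbrev OrderIdeal (M : Type u) [AddCommMonoid M] : Type u :=
  {I : AddSubmonoid M // ∀ x y : M, x + y ∈ I → x ∈ I ∧ y ∈ I}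

namespace RowFiniteGraph

/-! ### The graph algebra -/

/-- The generators `p_a` (`a` a vertex), `x_e`, `y_e` (`e` an edge). -/
inductive Gen (E : RowFiniteGraph.{u, v}) : Type (max u v)
  | p : E.Vert → Gen E
  | x : E.Edge → Gen E
  | y : E.Edge → Gen E

section

variable (K : Type w) [Field K] (E : RowFiniteGraph.{u, v})

/-- A generator, as an element of the free unital `K`-algebra on the generators. -/
noncomputable def freeGen (g : E.Gen) : FreeAlgebra K E.Gen := FreeAlgebra.ι K g

/-- The defining relations of the graph algebra. -/
inductive AlgRel : FreeAlgebra K E.Gen → FreeAlgebra K E.Gen → Prop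
  | p_mul_self (a : E.Vert) :
      AlgRel (E.freeGen K (.p a) * E.freeGen K (.p a)) (E.freeGen K (.p a))
  | p_mul_of_ne (a b : E.Vert) : a ≠ b →
      AlgRel (E.freeGen K (.p a) * E.freeGen K (.p b)) 0
  | p_mul_x (e : E.Edge) :
      AlgRel (E.freeGen K (.p (E.src e)) * E.freeGen K (.x e)) (E.freeGen K (.x e))
  | x_mul_p (e : E.Edge) :
      AlgRel (E.freeGen K (.x e) * E.freeGen K (.p (E.rng e))) (E.freeGen K (.x e))
  | p_mul_y (e : E.Edge) :
      AlgRel (E.freeGen K (.p (E.rng e)) * E.freeGen K (.y e)) (E.freeGen K (.y e))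
  | y_mul_p (e : E.Edge) :
      AlgRel (E.freeGen K (.y e) * E.freeGen K (.p (E.src e))) (E.freeGen K (.y e))
  | y_mul_x_self (e : E.Edge) :
      AlgRel (E.freeGen K (.y e) * E.freeGen K (.x e)) (E.freeGen K (.p (E.rng e)))
  | y_mul_x_of_ne (e f : E.Edge) : e ≠ f →
      AlgRel (E.freeGen K (.y e) * E.freeGen K (.x f)) 0
  | p_eq_sum (a : E.Vert) : (∃ e : E.Edge, E.src e = a) →
      AlgRel (E.freeGen K (.p a)) (∑ e ∈ E.emit a, E.freeGen K (.x e) * E.freeGen K (.y e))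

/-- The unital `K`-algebra presented by the generators and relations. No relation involves the
unit, so this is the algebra `L_K(E)` below with a unit freely adjoined. -/
def UnitalAlg : Type (max u v w) := RingQuot (E.AlgRel K)

noncomputable instance : Ring (E.UnitalAlg K) := inferInstanceAs (Ring (RingQuot (E.AlgRel K)))

noncomputable instance : Algebra K (E.UnitalAlg K) :=
  inferInstanceAs (Algebra K (RingQuot (E.AlgRel K)))

/-- The image of a generator in the unital presented algebra. -/
noncomputable def unitalGen (g : E.Gen) : E.UnitalAlg K :=
  RingQuot.mkAlgHom K (E.AlgRel K) (E.freeGen K g)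

/-- The graph algebra `L_K(E)`: the (not necessarily unital) `K`-algebra presented by the generators
`p_a`, `x_e`, `y_e` and the relations above. The free non-unital algebra is the ideal of the free
unital algebra spanned by the nonempty words; it contains all the relators, so the presented
non-unital algebra is its image in the presented unital algebra, that is, the non-unital
subalgebra generated by the generators. -/
abbrev GraphAlg : Type (max u v w) :=
  ↥(NonUnitalAlgebra.adjoin K (Set.range (E.unitalGen K)))

/-- The generators as elements of `L_K(E)`. -/
noncomputable def gen (g : E.Gen) : E.GraphAlg K :=
  ⟨E.unitalGen K g, NonUnitalAlgebra.subset_adjoin K ⟨g, rfl⟩⟩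

/-- The degree of a generator: `0` for `p_a`, `1` for `x_e` and `-1` for `y_e`. -/
def genDeg : E.Gen → ℤ
  | .p _ => 0
  | .x _ => 1
  | .y _ => -1

/-- `E.IsMonomial K n m`: the element `m` of `L_K(E)` is a product of finitely many (at least one)
generators, with total degree `n`. -/
inductive IsMonomial : ℤ → E.GraphAlg K → Prop
  | of (g : E.Gen) : IsMonomial (E.genDeg g) (E.gen K g)
  | mul {m n : ℤ} {a b : E.GraphAlg K} :
      IsMonomial m a → IsMonomial n b → IsMonomial (m + n) (a * b)

/-- The homogeneous component `L_K(E)_n`. -/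
noncomputable def component (n : ℤ) : Submodule K (E.GraphAlg K) :=
  Submodule.span K {m | E.IsMonomial K n m}

theorem mul_mem_component {m n : ℤ} {a b : E.GraphAlg K}
    (ha : a ∈ E.component K m) (hb : b ∈ E.component K n) :
    a * b ∈ E.component K (m + n) := by
  induction ha using Submodule.span_induction with
  | mem a ha =>
    induction hb using Submodule.span_induction with
    | mem b hb => exact Submodule.subset_span (IsMonomial.mul ha hb)
    | zero => simp
    | add b c _ _ hb hc => rw [mul_add]; exact add_mem hb hc
    | smul k b _ hb => rw [mul_smul_comm]; exact Submodule.smul_mem _ k hb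
  | zero => simp
  | add a c _ _ ha hc => rw [add_mul]; exact add_mem ha hc
  | smul k a _ ha => rw [smul_mul_assoc]; exact Submodule.smul_mem _ k ha

/-- The degree zero part `L_K(E)_0`, as a (not necessarily unital) `K`-algebra. -/
noncomputable def zeroPart : NonUnitalSubalgebra K (E.GraphAlg K) where
  carrier := E.component K 0
  add_mem' := add_mem
  zero_mem' := zero_mem _
  mul_mem' := fun ha hb => E.mul_mem_component K (m := 0) (n := 0) ha hb
  smul_mem' := fun k _ ha => Submodule.smul_mem _ k ha

/-- The homogeneous part `I_n = I ∩ L_K(E)_n` of a two-sided ideal `I`. -/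
noncomputable def idealPart (I : TwoSidedIdeal (E.GraphAlg K)) (n : ℤ) : AddSubgroup (E.GraphAlg K) :=
  AddSubgroup.ofClass I ⊓ (E.component K n).toAddSubgroup

/-- The two-sided ideal `I` is graded: it is the internal direct sum of the `I_n`. -/
def IsGradedIdeal (I : TwoSidedIdeal (E.GraphAlg K)) : Prop :=
  iSupIndep (E.idealPart K I) ∧ ⨆ n : ℤ, E.idealPart K I n = AddSubgroup.ofClass I

/-- The graded two-sided ideals of `L_K(E)`, ordered by inclusion. -/
abbrev GradedIdeal : Type (max u v w) :=
  {I : TwoSidedIdeal (E.GraphAlg K) // E.IsGradedIdeal K I}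

end

end RowFiniteGraph

/-! ### Ultramatricial algebras -/

/-- The matricial `K`-algebra `M_{n_0}(K) × ⋯ × M_{n_{k-1}}(K)`; `d` is `(k, (n_0, …, n_{k-1}))`. -/
abbrev MatricialAlg (K : Type w) [Field K] (d : Σ k : ℕ, Fin k → ℕ) : Type w :=
  ∀ j : Fin d.1, Matrix (Fin (d.2 j)) (Fin (d.2 j)) K

/-- The maps `g i : A i → B` make `B` the direct limit of the directed system `(A i, f i j)` of
`K`-algebras and not necessarily unital homomorphisms. -/
structure IsAlgDirectLimit (K : Type w) [Field K] {ι : Type u} [Preorder ι]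
    {A : ι → Type w} [∀ i, NonUnitalRing (A i)] [∀ i, Module K (A i)]
    {B : Type v} [NonUnitalRing B] [Module K B]
    (f : ∀ i j : ι, i ≤ j → (A i →ₙₐ[K] A j)) (g : ∀ i : ι, A i →ₙₐ[K] B) : Prop where
  map_self : ∀ (i : ι) (a : A i), f i i le_rfl a = a
  map_map : ∀ (i j k : ι) (hij : i ≤ j) (hjk : j ≤ k) (a : A i),
    f j k hjk (f i j hij a) = f i k (hij.trans hjk) a
  compat : ∀ (i j : ι) (hij : i ≤ j) (a : A i), g j (f i j hij a) = g i a
  exists_rep : ∀ b : B, ∃ (i : ι) (a : A i), g i a = b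
  exact : ∀ (i : ι) (a : A i), g i a = 0 → ∃ (j : ι) (hij : i ≤ j), f i j hij a = 0

/-- `B` is an ultramatricial `K`-algebra: a direct limit, over a nonempty directed set, of matricial
`K`-algebras and not necessarily unital homomorphisms. -/
def IsUltramatricial (K : Type w) [Field K] (B : Type v) [NonUnitalRing B] [Module K B] : Prop :=
  ∃ (ι : Type v) (_ : Preorder ι) (_ : Nonempty ι) (_ : IsDirectedOrder ι)
    (d : ι → Σ k : ℕ, Fin k → ℕ)
    (f : ∀ i j : ι, i ≤ j → (MatricialAlg K (d i) →ₙₐ[K] MatricialAlg K (d j)))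
    (g : ∀ i : ι, MatricialAlg K (d i) →ₙₐ[K] B),
    IsAlgDirectLimit K f g

namespace RowFiniteGraph

/-! The set `H` of vertices is the common invariant. On the monoid side, a class of `M_E` has all or
none of its representatives supported in a saturated hereditary `H`: for the defining relation at
`a`, heredity is one implication and saturation the other (`addConGen_le_supportCon`). So the
classes supported in `H` form an order-ideal whose vertices are exactly `H`.

On the algebra side, every monomial is zero or of the form `α β*` for paths `α`, `β` with a common
end. Expanding ends that emit edges brings a homogeneous element to a combination of normal forms at
a single level `N`; there `α* z β` isolates one coefficient times the vertex at the common end.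
Hence a graded ideal is generated by its vertices (`vertIdeal_vertSet`). Conversely, the ideal
generated by a saturated hereditary `H` contains no other vertices, because some representation
kills exactly the vertices of `H` (`exists_representation`). This gives an isomorphism from
`SatHered` to graded ideals; `θ` is its composite with the inverse of `φ`.

In degree zero the normal forms at level `N` with sources in a finite set are matrix units, grouped
into blocks by length and end. Their spans are matricial, directed, and exhaust `L_K(E)_0`. Vertices
being idempotents, the last claim follows from generation by vertices. -/

theorem mem_emit (E : RowFiniteGraph.{u, v}) {a : E.Vert} {e : E.Edge} :
    e ∈ E.emit a ↔ E.src e = a := by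
  simp [emit]

theorem IsHereditary.rng_mem {E : RowFiniteGraph.{u, v}} {H : Set E.Vert} (h : E.IsHereditary H)
    {e : E.Edge} (he : E.src e ∈ H) : E.rng e ∈ H :=
  h _ _ (Relation.ReflTransGen.single ⟨e, rfl, rfl⟩) he

theorem isHereditary_of_rng_mem {E : RowFiniteGraph.{u, v}} {H : Set E.Vert}
    (h : ∀ e : E.Edge, E.src e ∈ H → E.rng e ∈ H) : E.IsHereditary H := by
  intro a b hab ha
  induction hab with
  | refl => exact ha
  | tail _ hbc ih =>
    obtain ⟨e, rfl, rfl⟩ := hbc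
    exact h e ih

/-! ### Order-ideals of the graph monoid -/

/-- No cancellation occurs in `ℕ`: a sum of coefficients vanishes only if both do. This is the
source of the order-ideal property. -/
theorem add_mem_supported_iff {α : Type*} {s : Set α} {x y : α →₀ ℕ} :
    x + y ∈ Finsupp.supported ℕ ℕ s ↔
      x ∈ Finsupp.supported ℕ ℕ s ∧ y ∈ Finsupp.supported ℕ ℕ s := by
  simp only [Finsupp.mem_supported', Finsupp.add_apply, Nat.add_eq_zero_iff, forall_and]

/-- The congruence identifying elements of the free abelian monoid whose supports are
simultaneously contained or not contained in `H`. -/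
def supportCon (E : RowFiniteGraph.{u, v}) (H : Set E.Vert) : AddCon (E.Vert →₀ ℕ) where
  r x y := (x ∈ Finsupp.supported ℕ ℕ H) ↔ (y ∈ Finsupp.supported ℕ ℕ H)
  iseqv := ⟨fun _ => Iff.rfl, fun h => h.symm, fun h h' => h.trans h'⟩
  add' := by
    intro a b c d h h'
    rw [add_mem_supported_iff, add_mem_supported_iff, h, h']

theorem single_mem_supported_iff {α : Type*} {s : Set α} {a : α} :
    Finsupp.single a 1 ∈ Finsupp.supported ℕ ℕ s ↔ a ∈ s := by
  simp [Finsupp.mem_supported]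

theorem sum_single_mem_supported_iff {α ι : Type*} {s : Set α} {t : Finset ι} {f : ι → α} :
    ∑ i ∈ t, Finsupp.single (f i) 1 ∈ Finsupp.supported ℕ ℕ s ↔ ∀ i ∈ t, f i ∈ s := by
  classical
  induction t using Finset.induction_on with
  | empty => simp
  | insert i t hi ih =>
    rw [Finset.sum_insert hi, add_mem_supported_iff, ih, single_mem_supported_iff,
      Finset.forall_mem_insert]

/-- It is enough to check the generating relations, where heredity and saturation give the two
implications. Consequently any representative of a class decides whether it is supported in `H`. -/
theorem addConGen_le_supportCon {E : RowFiniteGraph.{u, v}} {H : Set E.Vert}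
    (h : E.IsHereditary H ∧ E.IsSaturated H) : addConGen E.MonoidRel ≤ E.supportCon H := by
  refine AddCon.addConGen_le.2 ?_
  rintro _ _ ⟨a, ha, rfl, rfl⟩
  change _ ↔ _
  rw [single_mem_supported_iff, sum_single_mem_supported_iff]
  constructor
  · rintro h' e he
    rw [mem_emit] at he
    exact h.1.rng_mem (he ▸ h')
  · intro h'
    exact h.2 a ha fun e he => h' e (E.mem_emit.2 he)

/-- The order-ideal of the graph monoid of the classes of elements supported in `H`. -/
noncomputable def orderIdealOf (E : RowFiniteGraph.{u, v}) (H : E.SatHered) : OrderIdeal E.GraphMonoid :=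
  ⟨(Finsupp.supported ℕ ℕ H.1).toAddSubmonoid.map (addConGen E.MonoidRel).mk', by
    intro x y
    induction x, y using AddCon.induction_on₂ with
    | _ x y =>
    rintro ⟨z, hz, hxy⟩
    have : addConGen E.MonoidRel z (x + y) := (AddCon.eq _).1 hxy
    have := (addConGen_le_supportCon H.2 this).1 hz
    rw [add_mem_supported_iff] at this
    exact ⟨⟨x, this.1, rfl⟩, ⟨y, this.2, rfl⟩⟩⟩

theorem vertClass_mem_orderIdealOf {E : RowFiniteGraph.{u, v}} {H : E.SatHered} {a : E.Vert} :
    E.vertClass a ∈ (E.orderIdealOf H).1 ↔ a ∈ H.1 := by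
  constructor
  · rintro ⟨z, hz, hza⟩
    have : addConGen E.MonoidRel z (Finsupp.single a 1) := (AddCon.eq _).1 hza
    exact single_mem_supported_iff.1 ((addConGen_le_supportCon H.2 this).1 hz)
  · intro h
    exact ⟨_, single_mem_supported_iff.2 h, rfl⟩

theorem vertClass_eq_sum {E : RowFiniteGraph.{u, v}} {a : E.Vert}
    (ha : ∃ e : E.Edge, E.src e = a) : E.vertClass a = ∑ e ∈ E.emit a, E.vertClass (E.rng e) := by
  have : E.vertClass a = (addConGen E.MonoidRel).mk' (∑ e ∈ E.emit a, Finsupp.single (E.rng e) 1) :=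
    (AddCon.eq _).2 (AddConGen.Rel.of _ _ ⟨a, ha, rfl, rfl⟩)
  rw [this, map_sum]
  rfl

theorem _root_.OrderIdeal.sum_mem_iff {M : Type*} [AddCommMonoid M] (I : OrderIdeal M) {ι : Type*}
    {t : Finset ι} {f : ι → M} : ∑ i ∈ t, f i ∈ I.1 ↔ ∀ i ∈ t, f i ∈ I.1 := by
  classical
  refine ⟨fun h => ?_, fun h => sum_mem h⟩
  induction t using Finset.induction_on with
  | empty => simp
  | insert i t hi ih =>
    rw [Finset.sum_insert hi] at h
    rw [Finset.forall_mem_insert]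
    exact ⟨(I.2 _ _ h).1, ih (I.2 _ _ h).2⟩

/-- The saturated hereditary set of the vertices whose class lies in an order-ideal. -/
def satHeredOf (E : RowFiniteGraph.{u, v}) (I : OrderIdeal E.GraphMonoid) : E.SatHered :=
  ⟨{a | E.vertClass a ∈ I.1}, by
    constructor
    · refine isHereditary_of_rng_mem fun e he => ?_
      rw [Set.mem_ofPred_eq, vertClass_eq_sum ⟨e, rfl⟩, I.sum_mem_iff] at he
      exact he e (E.mem_emit.2 rfl)
    · intro a ha h
      rw [Set.mem_ofPred_eq, vertClass_eq_sum ha, I.sum_mem_iff]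
      exact fun e he => h e (E.mem_emit.1 he)⟩

theorem orderIdealOf_le_iff {E : RowFiniteGraph.{u, v}} {H : E.SatHered}
    {I : OrderIdeal E.GraphMonoid} :
    E.orderIdealOf H ≤ I ↔ ∀ a ∈ H.1, E.vertClass a ∈ I.1 := by
  constructor
  · intro h a ha
    exact h (vertClass_mem_orderIdealOf.2 ha)
  · rintro h _ ⟨z, hz, rfl⟩
    rw [← z.sum_single, Finsupp.sum, map_sum]
    refine sum_mem fun a ha => ?_
    have : (addConGen E.MonoidRel).mk' (Finsupp.single a (z a)) = z a • E.vertClass a := by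
      rw [← mul_one (z a), ← smul_eq_mul, ← Finsupp.smul_single, map_nsmul, smul_eq_mul, mul_one]
      rfl
    rw [this]
    exact nsmul_mem (h a (hz ha)) _

/-- Each vertex in the support of a representative is a summand of it, so its class lies in `I` by
the order-ideal property. -/
theorem le_orderIdealOf_satHeredOf {E : RowFiniteGraph.{u, v}} (I : OrderIdeal E.GraphMonoid) :
    I ≤ E.orderIdealOf (E.satHeredOf I) := by
  intro x hx
  induction x using AddCon.induction_on with
  | _ z =>
  refine ⟨z, fun a ha => ?_, rfl⟩
  obtain ⟨y, rfl⟩ : ∃ y, z = Finsupp.single a 1 + y := by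
    refine exists_add_of_le (Finsupp.single_le_iff.2 ?_)
    exact Nat.one_le_iff_ne_zero.2 (Finsupp.mem_support_iff.1 ha)
  exact (I.2 (E.vertClass a) ((addConGen E.MonoidRel).mk' y) hx).1

/-- The order-isomorphism between saturated hereditary sets and order-ideals of the monoid. -/
noncomputable def satHeredOrderIso (E : RowFiniteGraph.{u, v}) : E.SatHered ≃o OrderIdeal E.GraphMonoid where
  toFun := E.orderIdealOf
  invFun := E.satHeredOf
  left_inv H := Subtype.ext (Set.ext fun _ => vertClass_mem_orderIdealOf)
  right_inv I := le_antisymm (orderIdealOf_le_iff.2 fun _ ha => ha) (le_orderIdealOf_satHeredOf I)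
  map_rel_iff' {H H'} := by
    change E.orderIdealOf H ≤ E.orderIdealOf H' ↔ _
    rw [orderIdealOf_le_iff]
    exact forall₂_congr fun _ _ => vertClass_mem_orderIdealOf

end RowFiniteGraph

/-! ### Criteria for ultramatricial algebras -/

/-- Injectivity of the embeddings forces the connecting maps and proves their identities, which can
be tested in `B`; the exactness condition is then immediate. Indexing by `Set.range S` instead of
`J` puts the index type in the universe of `B`. -/
theorem isUltramatricial_of_directed (K : Type w) [Field K] (B : Type v) [NonUnitalRing B]
    [Module K B] {J : Type*} [Nonempty J] (S : J → Set B) (hdir : Directed (· ⊆ ·) S)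
    (hcover : ∀ b, ∃ j, b ∈ S j)
    (hS : ∀ j, ∃ (d : Σ k : ℕ, Fin k → ℕ) (g : MatricialAlg K d →ₙₐ[K] B),
      Function.Injective g ∧ Set.range g = S j) :
    IsUltramatricial K B := by
  have hS' : ∀ i : Set.range S, ∃ (d : Σ k : ℕ, Fin k → ℕ) (g : MatricialAlg K d →ₙₐ[K] B),
      Function.Injective g ∧ Set.range g = i.1 := by
    rintro ⟨_, j, rfl⟩
    exact hS j
  choose d g hinj hrange using hS'
  have hex : ∀ (i j : Set.range S), i ≤ j → ∀ a, ∃ b, g j b = g i a := by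
    intro i j hij a
    have : g i a ∈ Set.range (g j) := by
      rw [hrange]
      exact hij (hrange i ▸ Set.mem_range_self a)
    exact this
  choose f hf using hex
  let f' : ∀ i j : Set.range S, i ≤ j → (MatricialAlg K (d i) →ₙₐ[K] MatricialAlg K (d j)) :=
    fun i j hij =>
      { toFun := f i j hij
        map_smul' := fun c a => hinj j (by simp only [hf, map_smul, MonoidHom.id_apply])
        map_zero' := hinj j (by simp only [hf, map_zero])
        map_add' := fun a b => hinj j (by simp only [hf, map_add])
        map_mul' := fun a b => hinj j (by simp only [hf, map_mul]) }
  have hf' : ∀ i j hij a, g j (f' i j hij a) = g i a := hf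
  refine ⟨Set.range S, inferInstance, inferInstance, ⟨?_⟩, d, f', g, ?_⟩
  · rintro ⟨_, i, rfl⟩ ⟨_, j, rfl⟩
    obtain ⟨k, hik, hjk⟩ := hdir i j
    exact ⟨⟨_, k, rfl⟩, hik, hjk⟩
  · refine ⟨fun i a => hinj i (hf' _ _ _ _), fun i j k hij hjk a => hinj k ?_, hf', fun b => ?_,
      fun i a ha => ⟨i, le_rfl, hinj i ?_⟩⟩
    · rw [hf', hf', hf']
    · obtain ⟨j, hj⟩ := hcover b
      obtain ⟨a, ha⟩ := (Set.ext_iff.1 (hrange ⟨_, j, rfl⟩) b).2 hj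
      exact ⟨_, a, ha⟩
    · rw [hf', ha, map_zero]

/-- The blocks are the fibres of `τ`, enumerated separately; the block index enumerates the range of
`τ`. -/
theorem exists_sigma_fin_equiv {P : Type u} [Finite P] {T : Type v} (τ : P → T) :
    ∃ (d : Σ k : ℕ, Fin k → ℕ) (q : (Σ j : Fin d.1, Fin (d.2 j)) ≃ P),
      ∀ s t, τ (q s) = τ (q t) ↔ s.1 = t.1 := by
  obtain ⟨k, ⟨e⟩⟩ := Finite.exists_equiv_fin (Set.range τ)
  have hfib : ∀ j : Fin k, ∃ n, Nonempty (Fin n ≃ {p : P // e (Set.rangeFactorization τ p) = j}) := by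
    intro j
    obtain ⟨n, ⟨f⟩⟩ := Finite.exists_equiv_fin {p : P // e (Set.rangeFactorization τ p) = j}
    exact ⟨n, ⟨f.symm⟩⟩
  choose n hn using hfib
  refine ⟨⟨k, n⟩, (Equiv.sigmaCongrRight fun j => (hn j).some).trans
    (Equiv.sigmaFiberEquiv fun p => e (Set.rangeFactorization τ p)), fun s t => ?_⟩
  have key : ∀ s : Σ j, Fin (n j), e (Set.rangeFactorization τ ((hn s.1).some s.2).1) = s.1 :=
    fun s => ((hn s.1).some s.2).2
  have : τ ((hn s.1).some s.2).1 = τ ((hn t.1).some t.2).1 ↔ s.1 = t.1 := by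
    have h : e (Set.rangeFactorization τ ((hn s.1).some s.2).1) =
        e (Set.rangeFactorization τ ((hn t.1).some t.2).1) ↔ s.1 = t.1 := by
      rw [key s, key t]
    rwa [e.apply_eq_iff_eq, Subtype.ext_iff] at h
  exact this

/-- Elements `X s`, `Y t` such that the products `X s * Y t`, for `s` and `t` in the same block, are
matrix units yield an embedding of a matricial algebra. -/
theorem exists_matricial_hom (K : Type w) [Field K] {B : Type v} [NonUnitalRing B]
    [Module K B] [IsScalarTower K B B] [SMulCommClass K B B]
    (d : Σ k : ℕ, Fin k → ℕ) (X Y p : (Σ j : Fin d.1, Fin (d.2 j)) → B)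
    (hYX : ∀ s t, s ≠ t → Y s * X t = 0) (hYX' : ∀ s, Y s * X s = p s)
    (hX : ∀ j a b, X ⟨j, a⟩ * p ⟨j, b⟩ = X ⟨j, a⟩) (hp : ∀ j a b, p ⟨j, a⟩ * p ⟨j, b⟩ ≠ 0) :
    ∃ g : MatricialAlg K d →ₙₐ[K] B, Function.Injective g ∧
      ∀ M, g M = ∑ j, ∑ a, ∑ b, M j a b • (X ⟨j, a⟩ * Y ⟨j, b⟩) := by
  have hmul : ∀ j a b j' c e, (X ⟨j, a⟩ * Y ⟨j, b⟩) * (X ⟨j', c⟩ * Y ⟨j', e⟩) =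
      if (⟨j, b⟩ : Σ j : Fin d.1, Fin (d.2 j)) = ⟨j', c⟩ then X ⟨j, a⟩ * Y ⟨j', e⟩ else 0 := by
    intro j a b j' c e
    have h1 : (X ⟨j, a⟩ * Y ⟨j, b⟩) * (X ⟨j', c⟩ * Y ⟨j', e⟩) =
        X ⟨j, a⟩ * (Y ⟨j, b⟩ * X ⟨j', c⟩) * Y ⟨j', e⟩ := by noncomm_ring
    rw [h1]
    split_ifs with h
    · rw [← h, hYX', hX]
    · rw [hYX _ _ h, mul_zero, zero_mul]
  have hleft : ∀ (M : MatricialAlg K d) j c e,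
      (∑ j, ∑ a, ∑ b, M j a b • (X ⟨j, a⟩ * Y ⟨j, b⟩)) * (X ⟨j, c⟩ * Y ⟨j, e⟩) =
        ∑ a, M j a c • (X ⟨j, a⟩ * Y ⟨j, e⟩) := by
    intro M j c e
    simp only [Finset.sum_mul, smul_mul_assoc, hmul]
    rw [Finset.sum_eq_single j]
    · refine Finset.sum_congr rfl fun a _ => ?_
      rw [Finset.sum_eq_single c, if_pos rfl]
      · intro b _ hb
        rw [if_neg (by simpa using hb), smul_zero]
      · simp
    · intro j' _ hj
      refine Finset.sum_eq_zero fun a _ => Finset.sum_eq_zero fun b _ => ?_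
      rw [if_neg (fun h => hj (congrArg Sigma.fst h)), smul_zero]
    · simp
  let g : MatricialAlg K d →ₙₐ[K] B :=
    { toFun := fun M => ∑ j, ∑ a, ∑ b, M j a b • (X ⟨j, a⟩ * Y ⟨j, b⟩)
      map_smul' := fun c M => by
        simp only [Pi.smul_apply, Matrix.smul_apply, Finset.smul_sum, smul_eq_mul, mul_smul,
          MonoidHom.id_apply]
      map_zero' := by simp
      map_add' := fun M N => by
        simp only [Pi.add_apply, Matrix.add_apply, add_smul, Finset.sum_add_distrib]
      map_mul' := fun M N => by
        rw [Finset.mul_sum]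
        refine Finset.sum_congr rfl fun j _ => ?_
        simp only [Finset.mul_sum, mul_smul_comm, hleft, Finset.smul_sum, Pi.mul_apply,
          Matrix.mul_apply, Finset.sum_smul]
        rw [Finset.sum_congr rfl fun _ _ => Finset.sum_comm, Finset.sum_comm]
        refine Finset.sum_congr rfl fun c _ => ?_
        rw [Finset.sum_comm]
        refine Finset.sum_congr rfl fun e _ => Finset.sum_congr rfl fun a _ => ?_
        rw [smul_smul, mul_comm] }
  -- Compressing by `Y` on the left and `X` on the right isolates one matrix entry times a nonzero
  -- element, which yields injectivity.
  have hcoef : ∀ M : MatricialAlg K d, ∀ j a b,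
      Y ⟨j, a⟩ * g M * X ⟨j, b⟩ = M j a b • (p ⟨j, a⟩ * p ⟨j, b⟩) := by
    intro M j a b
    change Y ⟨j, a⟩ * (∑ j, ∑ a, ∑ b, M j a b • (X ⟨j, a⟩ * Y ⟨j, b⟩)) * X ⟨j, b⟩ = _
    have hterm : ∀ j' a' b', Y ⟨j, a⟩ * (M j' a' b' • (X ⟨j', a'⟩ * Y ⟨j', b'⟩)) * X ⟨j, b⟩ =
        M j' a' b' • ((Y ⟨j, a⟩ * X ⟨j', a'⟩) * (Y ⟨j', b'⟩ * X ⟨j, b⟩)) := by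
      intro j' a' b'
      rw [mul_smul_comm, smul_mul_assoc]
      noncomm_ring
    simp only [Finset.mul_sum, Finset.sum_mul, hterm]
    rw [Finset.sum_eq_single j, Finset.sum_eq_single a, Finset.sum_eq_single b]
    · rw [hYX', hYX']
    · intro b' _ hb
      rw [hYX ⟨j, b'⟩ ⟨j, b⟩ (by simpa using hb), mul_zero, smul_zero]
    · simp
    · intro a' _ ha
      refine Finset.sum_eq_zero fun b' _ => ?_
      rw [hYX ⟨j, a⟩ ⟨j, a'⟩ (by simpa using ha.symm), zero_mul, smul_zero]
    · simp
    · intro j' _ hj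
      refine Finset.sum_eq_zero fun a' _ => Finset.sum_eq_zero fun b' _ => ?_
      rw [hYX ⟨j, a⟩ ⟨j', a'⟩ (fun h => hj (congrArg Sigma.fst h).symm), zero_mul, smul_zero]
    · simp
  refine ⟨g, (injective_iff_map_eq_zero g).2 fun M hM => ?_, fun _ => rfl⟩
  ext j a b
  have := hcoef M j a b
  rw [hM, mul_zero, zero_mul] at this
  exact (smul_eq_zero.1 this.symm).resolve_right (hp j a b)

namespace RowFiniteGraph

section

variable (K : Type w) [Field K] (E : RowFiniteGraph.{u, v})

/-! ### Relations in the graph algebra -/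

/-- The defining relations, in the unital algebra. -/
theorem mkAlgHom_eq {a b : FreeAlgebra K E.Gen} (h : E.AlgRel K a b) :
    RingQuot.mkAlgHom K (E.AlgRel K) a = RingQuot.mkAlgHom K (E.AlgRel K) b :=
  RingQuot.mkAlgHom_rel K h

theorem gen_p_mul_self (a : E.Vert) : E.gen K (.p a) * E.gen K (.p a) = E.gen K (.p a) :=
  Subtype.ext <| by simpa only [map_mul] using! E.mkAlgHom_eq K (.p_mul_self a)

theorem gen_p_mul_of_ne {a b : E.Vert} (h : a ≠ b) : E.gen K (.p a) * E.gen K (.p b) = 0 :=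
  Subtype.ext <| by simpa only [map_mul, map_zero] using! E.mkAlgHom_eq K (.p_mul_of_ne a b h)

theorem gen_p_mul_x (e : E.Edge) :
    E.gen K (.p (E.src e)) * E.gen K (.x e) = E.gen K (.x e) :=
  Subtype.ext <| by simpa only [map_mul] using! E.mkAlgHom_eq K (.p_mul_x e)

theorem gen_x_mul_p (e : E.Edge) :
    E.gen K (.x e) * E.gen K (.p (E.rng e)) = E.gen K (.x e) :=
  Subtype.ext <| by simpa only [map_mul] using! E.mkAlgHom_eq K (.x_mul_p e)

theorem gen_p_mul_y (e : E.Edge) :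
    E.gen K (.p (E.rng e)) * E.gen K (.y e) = E.gen K (.y e) :=
  Subtype.ext <| by simpa only [map_mul] using! E.mkAlgHom_eq K (.p_mul_y e)

theorem gen_y_mul_p (e : E.Edge) :
    E.gen K (.y e) * E.gen K (.p (E.src e)) = E.gen K (.y e) :=
  Subtype.ext <| by simpa only [map_mul] using! E.mkAlgHom_eq K (.y_mul_p e)

theorem gen_y_mul_x_self (e : E.Edge) :
    E.gen K (.y e) * E.gen K (.x e) = E.gen K (.p (E.rng e)) :=
  Subtype.ext <| by simpa only [map_mul] using! E.mkAlgHom_eq K (.y_mul_x_self e)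

theorem gen_y_mul_x_of_ne {e f : E.Edge} (h : e ≠ f) :
    E.gen K (.y e) * E.gen K (.x f) = 0 :=
  Subtype.ext <| by simpa only [map_mul, map_zero] using! E.mkAlgHom_eq K (.y_mul_x_of_ne e f h)

theorem gen_p_eq_sum {a : E.Vert} (h : ∃ e : E.Edge, E.src e = a) :
    E.gen K (.p a) = ∑ e ∈ E.emit a, E.gen K (.x e) * E.gen K (.y e) :=
  Subtype.ext <| by
    rw [AddSubmonoidClass.coe_finsetSum]
    simpa only [map_sum, map_mul] using! E.mkAlgHom_eq K (.p_eq_sum a h)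

theorem gen_p_mul_x_of_ne {a : E.Vert} {e : E.Edge} (h : a ≠ E.src e) :
    E.gen K (.p a) * E.gen K (.x e) = 0 := by
  rw [← gen_p_mul_x, ← mul_assoc, gen_p_mul_of_ne K E h, zero_mul]

theorem gen_y_mul_p_of_ne {a : E.Vert} {e : E.Edge} (h : E.src e ≠ a) :
    E.gen K (.y e) * E.gen K (.p a) = 0 := by
  rw [← gen_y_mul_p, mul_assoc, gen_p_mul_of_ne K E h, mul_zero]

theorem gen_x_mul_p_of_ne {a : E.Vert} {e : E.Edge} (h : E.rng e ≠ a) :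
    E.gen K (.x e) * E.gen K (.p a) = 0 := by
  rw [← gen_x_mul_p, mul_assoc, gen_p_mul_of_ne K E h, mul_zero]

/-! ### Paths -/

/-- The list of edges is a path from the first vertex to the last one. -/
def IsPath : E.Vert → List E.Edge → E.Vert → Prop
  | a, [], b => a = b
  | a, e :: l, b => E.src e = a ∧ IsPath (E.rng e) l b

/-- The product of the `x_e` along a list of edges, times `p_a` for a terminal vertex `a`. -/
noncomputable def pathX : List E.Edge → E.Vert → E.GraphAlg K
  | [], a => E.gen K (.p a)
  | e :: l, a => E.gen K (.x e) * pathX l a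

/-- `p_a` for a terminal vertex `a`, times the product of the `y_e` along the reversed list. -/
noncomputable def pathY : List E.Edge → E.Vert → E.GraphAlg K
  | [], a => E.gen K (.p a)
  | e :: l, a => pathY l a * E.gen K (.y e)

@[simp] theorem pathX_nil (a : E.Vert) : E.pathX K [] a = E.gen K (.p a) := rfl
@[simp] theorem pathY_nil (a : E.Vert) : E.pathY K [] a = E.gen K (.p a) := rfl
@[simp] theorem pathX_cons (e : E.Edge) (l : List E.Edge) (a : E.Vert) :
    E.pathX K (e :: l) a = E.gen K (.x e) * E.pathX K l a := rfl
@[simp] theorem pathY_cons (e : E.Edge) (l : List E.Edge) (a : E.Vert) :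
    E.pathY K (e :: l) a = E.pathY K l a * E.gen K (.y e) := rfl

theorem pathX_mul_p (l : List E.Edge) (a : E.Vert) :
    E.pathX K l a * E.gen K (.p a) = E.pathX K l a := by
  induction l with
  | nil => exact E.gen_p_mul_self K a
  | cons e l ih => rw [pathX_cons, mul_assoc, ih]

theorem p_mul_pathY (l : List E.Edge) (a : E.Vert) :
    E.gen K (.p a) * E.pathY K l a = E.pathY K l a := by
  induction l with
  | nil => exact E.gen_p_mul_self K a
  | cons e l ih => rw [pathY_cons, ← mul_assoc, ih]

theorem p_mul_pathX (a b : E.Vert) (l : List E.Edge) :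
    E.gen K (.p a) * E.pathX K l b = E.pathX K l b ∨ E.gen K (.p a) * E.pathX K l b = 0 := by
  cases l with
  | nil =>
    by_cases h : a = b
    · subst h
      exact Or.inl (E.gen_p_mul_self K a)
    · exact Or.inr (E.gen_p_mul_of_ne K h)
  | cons e l =>
    rw [pathX_cons, ← mul_assoc]
    by_cases h : a = E.src e
    · subst h
      exact Or.inl (by rw [gen_p_mul_x])
    · exact Or.inr (by rw [E.gen_p_mul_x_of_ne K h, zero_mul])

variable {E}

theorem IsPath.p_mul_pathX {a b : E.Vert} {l : List E.Edge} (h : E.IsPath a l b) :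
    E.gen K (.p a) * E.pathX K l b = E.pathX K l b := by
  cases l with
  | nil =>
    obtain rfl : a = b := h
    exact E.gen_p_mul_self K a
  | cons e l => rw [← h.1, pathX_cons, ← mul_assoc, gen_p_mul_x]

theorem IsPath.pathY_mul_p {a b : E.Vert} {l : List E.Edge} (h : E.IsPath a l b) :
    E.pathY K l b * E.gen K (.p a) = E.pathY K l b := by
  cases l with
  | nil =>
    obtain rfl : a = b := h
    exact E.gen_p_mul_self K a
  | cons e l => rw [← h.1, pathY_cons, mul_assoc, gen_y_mul_p]

/-- Somewhere along the list two consecutive vertices disagree, and their orthogonality kills the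
product. This lets arbitrary lists of edges stand in for paths. -/
theorem pathX_eq_zero {b : E.Vert} {l : List E.Edge} (h : ∀ a, ¬ E.IsPath a l b) :
    E.pathX K l b = 0 := by
  induction l with
  | nil => exact absurd rfl (h b)
  | cons e l ih =>
    by_cases hl : ∃ a, E.IsPath a l b
    · obtain ⟨a, ha⟩ := hl
      have hne : E.rng e ≠ a := fun hea => h (E.src e) ⟨rfl, hea ▸ ha⟩
      rw [pathX_cons, ← ha.p_mul_pathX K, ← mul_assoc, E.gen_x_mul_p_of_ne K hne, zero_mul]
    · rw [pathX_cons, ih (not_exists.1 hl), mul_zero]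

theorem pathY_eq_zero {b : E.Vert} {l : List E.Edge} (h : ∀ a, ¬ E.IsPath a l b) :
    E.pathY K l b = 0 := by
  induction l with
  | nil => exact absurd rfl (h b)
  | cons e l ih =>
    by_cases hl : ∃ a, E.IsPath a l b
    · obtain ⟨a, ha⟩ := hl
      have hne : a ≠ E.rng e := fun hea => h (E.src e) ⟨rfl, hea ▸ ha⟩
      rw [pathY_cons, ← ha.pathY_mul_p K, ← gen_p_mul_y, mul_assoc, ← mul_assoc (E.gen K (.p a)),
        E.gen_p_mul_of_ne K hne, zero_mul, mul_zero]
    · rw [pathY_cons, ih (not_exists.1 hl), zero_mul]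

theorem pathX_concat (l : List E.Edge) (e : E.Edge) :
    E.pathX K (l ++ [e]) (E.rng e) = E.pathX K l (E.src e) * E.gen K (.x e) := by
  induction l with
  | nil => simp [gen_x_mul_p, gen_p_mul_x]
  | cons f l ih => rw [List.cons_append, pathX_cons, ih, pathX_cons, mul_assoc]

theorem pathY_concat (l : List E.Edge) (e : E.Edge) :
    E.pathY K (l ++ [e]) (E.rng e) = E.gen K (.y e) * E.pathY K l (E.src e) := by
  induction l with
  | nil => simp [gen_p_mul_y, gen_y_mul_p]
  | cons f l ih => rw [List.cons_append, pathY_cons, ih, pathY_cons, mul_assoc]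

theorem IsPath.concat {a : E.Vert} {l : List E.Edge} {e : E.Edge} (h : E.IsPath a l (E.src e)) :
    E.IsPath a (l ++ [e]) (E.rng e) := by
  induction l generalizing a with
  | nil => exact ⟨h.symm, rfl⟩
  | cons f l ih => exact ⟨h.1, ih h.2⟩

/-- Expansion of `α β*` by the relation at the common end of `α` and `β`. -/
theorem pathX_mul_pathY_eq_sum (α β : List E.Edge) {a : E.Vert} (ha : ∃ e : E.Edge, E.src e = a) :
    E.pathX K α a * E.pathY K β a =
      ∑ e ∈ E.emit a, E.pathX K (α ++ [e]) (E.rng e) * E.pathY K (β ++ [e]) (E.rng e) := by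
  rw [← pathX_mul_p, E.gen_p_eq_sum K ha, Finset.mul_sum, Finset.sum_mul]
  refine Finset.sum_congr rfl fun e he => ?_
  rw [mem_emit] at he
  subst he
  rw [pathX_concat, pathY_concat]
  noncomm_ring

/-- Orthogonality of paths. -/
theorem pathY_mul_pathX_self {a b : E.Vert} {α : List E.Edge} (h : E.IsPath a α b) :
    E.pathY K α b * E.pathX K α b = E.gen K (.p b) := by
  induction α generalizing a with
  | nil => exact E.gen_p_mul_self K b
  | cons e α ih =>
    rw [pathY_cons, pathX_cons, mul_assoc, ← mul_assoc (E.gen K (.y e)), gen_y_mul_x_self,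
      h.2.p_mul_pathX K, ih h.2]

/-- Common initial edges cancel, and the first pair of distinct edges gives zero. The only
obstruction is one path being a proper initial segment of the other, which is excluded by requiring
the shorter one to end at a sink. -/
theorem pathY_mul_pathX_of_ne {a b a' b' : E.Vert} {α α' : List E.Edge}
    (h : E.IsPath a α b) (h' : E.IsPath a' α' b')
    (hs : α.length < α'.length → ¬ ∃ e : E.Edge, E.src e = b)
    (hs' : α'.length < α.length → ¬ ∃ e : E.Edge, E.src e = b') (hne : (α, b) ≠ (α', b')) :
    E.pathY K α b * E.pathX K α' b' = 0 := by
  induction α generalizing a α' a' with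
  | nil =>
    cases α' with
    | nil =>
      refine E.gen_p_mul_of_ne K fun hb => hne ?_
      rw [hb]
    | cons f α' =>
      rw [pathY_nil, pathX_cons, ← mul_assoc, E.gen_p_mul_x_of_ne K (e := f), zero_mul]
      exact fun hb => hs (by simp) ⟨f, hb.symm⟩
  | cons e α ih =>
    cases α' with
    | nil =>
      rw [pathX_nil, pathY_cons, mul_assoc, E.gen_y_mul_p_of_ne K (e := e), mul_zero]
      exact fun hb => hs' (by simp) ⟨e, hb⟩
    | cons f α' =>
      rw [pathY_cons, pathX_cons, mul_assoc, ← mul_assoc (E.gen K (.y e))]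
      by_cases hef : e = f
      · subst hef
        rw [gen_y_mul_x_self, h'.2.p_mul_pathX K]
        refine ih h.2 h'.2 (fun hl => hs (by simpa using hl)) (fun hl => hs' (by simpa using hl)) ?_
        rintro hab
        rw [Prod.mk.injEq] at hab
        exact hne (by rw [hab.1, hab.2])
      · rw [E.gen_y_mul_x_of_ne K hef, zero_mul, mul_zero]

theorem finite_setOf_isPath (a : E.Vert) (n : ℕ) :
    {t : List E.Edge × E.Vert | E.IsPath a t.1 t.2 ∧ t.1.length = n}.Finite := by
  induction n generalizing a with
  | zero =>
    refine (Set.finite_singleton ([], a)).subset ?_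
    rintro ⟨l, b⟩ ⟨h, hl⟩
    obtain rfl := List.length_eq_zero_iff.1 hl
    obtain rfl : a = b := h
    rfl
  | succ n ih =>
    refine ((E.finite_emit a).biUnion fun e _ =>
      (ih (E.rng e)).image fun t => (e :: t.1, t.2)).subset ?_
    rintro ⟨l, b⟩ ⟨h, hl⟩
    cases l with
    | nil => simp at hl
    | cons e l =>
      exact Set.mem_biUnion (x := e) h.1 ⟨(l, b), ⟨h.2, by simpa using hl⟩, rfl⟩

end

end RowFiniteGraph

namespace RowFiniteGraph

section

variable (K : Type w) [Field K] (E : RowFiniteGraph.{u, v})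

/-! ### Monomials are of the form `α β*` -/

/-- Every element `α β*` of degree `n` is mapped by left multiplication by `m` to zero or to such an
element of degree `n + d`. -/
theorem IsMonomial.mul_pathX_mul_pathY {K : Type w} [Field K] {E : RowFiniteGraph.{u, v}} {d : ℤ}
    {m : E.GraphAlg K} (hm : E.IsMonomial K d m) (α β : List E.Edge) (a : E.Vert) :
    m * (E.pathX K α a * E.pathY K β a) = 0 ∨ ∃ α' β' a',
      m * (E.pathX K α a * E.pathY K β a) = E.pathX K α' a' * E.pathY K β' a' ∧
        (α'.length : ℤ) - β'.length = d + (α.length - β.length) := by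
  have hp : ∀ (b : E.Vert) (α β : List E.Edge) (a : E.Vert),
      E.gen K (.p b) * (E.pathX K α a * E.pathY K β a) = 0 ∨
      E.gen K (.p b) * (E.pathX K α a * E.pathY K β a) = E.pathX K α a * E.pathY K β a := by
    intro b α β a
    rw [← mul_assoc]
    rcases E.p_mul_pathX K b a α with h | h
    · exact Or.inr (by rw [h])
    · exact Or.inl (by rw [h, zero_mul])
  induction hm generalizing α β a with
  | of g =>
    cases g with
    | p b =>
      rcases hp b α β a with h | h
      · exact Or.inl h
      · exact Or.inr ⟨α, β, a, h, by simp [genDeg]⟩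
    | x e =>
      refine Or.inr ⟨e :: α, β, a, by rw [pathX_cons, mul_assoc], ?_⟩
      simp only [genDeg, List.length_cons]
      push_cast
      ring
    | y e =>
      cases α with
      | nil =>
        by_cases h : E.src e = a
        · subst h
          -- With no edge of `α` left to cancel, `y_e` is absorbed as a new last edge of `β`.
          refine Or.inr ⟨[], β ++ [e], E.rng e, ?_, ?_⟩
          · rw [pathX_nil, pathX_nil, p_mul_pathY, p_mul_pathY, pathY_concat]
          · simp only [genDeg, List.length_append, List.length_nil, List.length_singleton]
            push_cast
            ring
        · refine Or.inl ?_
          rw [pathX_nil, ← mul_assoc, E.gen_y_mul_p_of_ne K h, zero_mul]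
      | cons f α =>
        have h1 : E.gen K (.y e) * (E.pathX K (f :: α) a * E.pathY K β a) =
            E.gen K (.y e) * E.gen K (.x f) * (E.pathX K α a * E.pathY K β a) := by
          rw [pathX_cons]
          noncomm_ring
        by_cases h : e = f
        · subst h
          rw [h1, gen_y_mul_x_self]
          rcases hp (E.rng e) α β a with h | h
          · exact Or.inl h
          · refine Or.inr ⟨α, β, a, h, ?_⟩
            simp only [genDeg, List.length_cons]
            push_cast
            ring
        · exact Or.inl (by rw [h1, E.gen_y_mul_x_of_ne K h, zero_mul])
  | mul _ _ ih₁ ih₂ =>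
    rw [mul_assoc]
    rcases ih₂ α β a with h | ⟨α', β', a', h, hd⟩
    · exact Or.inl (by rw [h, mul_zero])
    · rw [h]
      rcases ih₁ α' β' a' with h' | ⟨α'', β'', a'', h', hd'⟩
      · exact Or.inl h'
      · exact Or.inr ⟨α'', β'', a'', h', by rw [hd', hd]; ring⟩

theorem IsMonomial.eq_pathX_mul_pathY {K : Type w} [Field K] {E : RowFiniteGraph.{u, v}} {d : ℤ}
    {m : E.GraphAlg K} (hm : E.IsMonomial K d m) :
    m = 0 ∨ ∃ α β a, m = E.pathX K α a * E.pathY K β a ∧ (α.length : ℤ) - β.length = d := by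
  induction hm with
  | of g =>
    refine Or.inr ?_
    cases g with
    | p a => exact ⟨[], [], a, (E.gen_p_mul_self K a).symm, by simp [genDeg]⟩
    | x e =>
      refine ⟨[e], [], E.rng e, ?_, by simp [genDeg]⟩
      rw [pathX_cons, pathX_nil, pathY_nil, mul_assoc, gen_p_mul_self, gen_x_mul_p]
    | y e =>
      refine ⟨[], [e], E.rng e, ?_, by simp [genDeg]⟩
      rw [pathY_cons, pathX_nil, pathY_nil, ← mul_assoc, gen_p_mul_self, gen_p_mul_y]
  | @mul d₁ d₂ m₁ m₂ h₁ h₂ ih₁ ih₂ =>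
    rcases ih₂ with h | ⟨α, β, a, rfl, hd⟩
    · exact Or.inl (by rw [h, mul_zero])
    · rw [← hd]
      exact h₁.mul_pathX_mul_pathY α β a

/-! ### Normal forms -/

/-- The triples `(α, β, a)` of paths `α`, `β` with sources in `F` and common end `a` such that
`|α| = |β| + n`, and `|β| = N` or `|β| < N` and `a` is a sink. -/
def normalForms (F : Set E.Vert) (n : ℤ) (N : ℕ) : Set (List E.Edge × List E.Edge × E.Vert) :=
  {t | (∃ b ∈ F, E.IsPath b t.1 t.2.2) ∧ (∃ b ∈ F, E.IsPath b t.2.1 t.2.2) ∧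
    (t.1.length : ℤ) = t.2.1.length + n ∧
    (t.2.1.length = N ∨ t.2.1.length < N ∧ ¬ ∃ e : E.Edge, E.src e = t.2.2)}

/-- The element `α β*` attached to `(α, β, a)`. -/
noncomputable def pathXY (t : List E.Edge × List E.Edge × E.Vert) : E.GraphAlg K :=
  E.pathX K t.1 t.2.2 * E.pathY K t.2.1 t.2.2

/-- The span of the elements `α β*` in normal form. -/
noncomputable def normalSpan (F : Set E.Vert) (n : ℤ) (N : ℕ) : Submodule K (E.GraphAlg K) :=
  Submodule.span K (E.pathXY K '' E.normalForms F n N)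

variable {E}

theorem normalSpan_mono_left {F F' : Set E.Vert} (h : F ⊆ F') (n : ℤ) (N : ℕ) :
    E.normalSpan K F n N ≤ E.normalSpan K F' n N := by
  refine Submodule.span_mono (Set.image_mono ?_)
  rintro t ⟨⟨b, hb, hb'⟩, ⟨c, hc, hc'⟩, ht⟩
  exact ⟨⟨b, h hb, hb'⟩, ⟨c, h hc, hc'⟩, ht⟩

/-- Passing from one level to the next, a term ending at a sink is kept, and any other term is
expanded by the relation at its end. Finitely many normal forms can thus be moved to a common level.
-/
theorem normalSpan_mono_right (F : Set E.Vert) (n : ℤ) {N N' : ℕ} (h : N ≤ N') :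
    E.normalSpan K F n N ≤ E.normalSpan K F n N' := by
  induction h with
  | refl => exact le_rfl
  | @step N' _ ih =>
    refine ih.trans (Submodule.span_le.2 ?_)
    rintro _ ⟨⟨α, β, a⟩, ⟨⟨b, hb, hα⟩, ⟨c, hc, hβ⟩, hd, hN⟩, rfl⟩
    by_cases ha : ∃ e : E.Edge, E.src e = a
    · have hl : β.length = N' := hN.resolve_right fun h => h.2 ha
      change E.pathX K α a * E.pathY K β a ∈ E.normalSpan K F n (N' + 1)
      rw [pathX_mul_pathY_eq_sum K α β ha]
      refine sum_mem fun e he => Submodule.subset_span ⟨(α ++ [e], β ++ [e], E.rng e), ?_, rfl⟩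
      rw [mem_emit] at he
      subst he
      refine ⟨⟨b, hb, hα.concat⟩, ⟨c, hc, hβ.concat⟩, ?_, Or.inl ?_⟩
      · simp only [List.length_append, List.length_singleton] at hd ⊢
        push_cast
        linarith
      · simp [hl]
    · refine Submodule.subset_span ⟨(α, β, a), ⟨⟨b, hb, hα⟩, ⟨c, hc, hβ⟩, hd, Or.inr ⟨?_, ha⟩⟩, rfl⟩
      rcases hN with h | h
      · exact h ▸ Nat.lt_succ_self _
      · exact h.1.trans (Nat.lt_succ_self _)

theorem normalSpan_mono {F F' : Set E.Vert} (h : F ⊆ F') (n : ℤ) {N N' : ℕ} (h' : N ≤ N') :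
    E.normalSpan K F n N ≤ E.normalSpan K F' n N' :=
  (normalSpan_mono_left K h n N).trans (normalSpan_mono_right K F' n h')

theorem pathX_mul_pathY_mem_normalSpan (α β : List E.Edge) (a : E.Vert) {n : ℤ}
    (hn : (α.length : ℤ) - β.length = n) : ∃ F : Finset E.Vert,
      E.pathX K α a * E.pathY K β a ∈ E.normalSpan K F n β.length := by
  classical
  by_cases hα : ∃ b, E.IsPath b α a
  · by_cases hβ : ∃ c, E.IsPath c β a
    · obtain ⟨b, hα⟩ := hα
      obtain ⟨c, hβ⟩ := hβ
      refine ⟨{b, c}, Submodule.subset_span ⟨(α, β, a), ⟨⟨b, by simp, hα⟩, ⟨c, by simp, hβ⟩, ?_,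
        Or.inl rfl⟩, rfl⟩⟩
      simp only
      linarith
    · refine ⟨∅, ?_⟩
      rw [pathY_eq_zero K (not_exists.1 hβ), mul_zero]
      exact zero_mem _
  · refine ⟨∅, ?_⟩
    rw [pathX_eq_zero K (not_exists.1 hα), zero_mul]
    exact zero_mem _

theorem exists_mem_normalSpan {n : ℤ} {z : E.GraphAlg K} (hz : z ∈ E.component K n) :
    ∃ (F : Finset E.Vert) (N : ℕ), z ∈ E.normalSpan K F n N := by
  classical
  induction hz using Submodule.span_induction with
  | mem m hm =>
    rcases IsMonomial.eq_pathX_mul_pathY hm with rfl | ⟨α, β, a, rfl, hd⟩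
    · exact ⟨∅, 0, zero_mem _⟩
    · obtain ⟨F, hF⟩ := pathX_mul_pathY_mem_normalSpan K α β a hd
      exact ⟨F, _, hF⟩
  | zero => exact ⟨∅, 0, zero_mem _⟩
  | add y z _ _ hy hz =>
    obtain ⟨F, N, hF⟩ := hy
    obtain ⟨F', N', hF'⟩ := hz
    refine ⟨F ∪ F', max N N', add_mem (normalSpan_mono K ?_ n (le_max_left _ _) hF)
      (normalSpan_mono K ?_ n (le_max_right _ _) hF')⟩
    · exact_mod_cast Finset.subset_union_left
    · exact_mod_cast Finset.subset_union_right
  | smul c z _ hz =>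
    obtain ⟨F, N, hF⟩ := hz
    exact ⟨F, N, Submodule.smul_mem _ c hF⟩

variable (E)

theorem pathX_mem_component (l : List E.Edge) (a : E.Vert) :
    E.pathX K l a ∈ E.component K l.length := by
  induction l with
  | nil => exact Submodule.subset_span (IsMonomial.of (.p a))
  | cons e l ih =>
    have h : E.gen K (.x e) ∈ E.component K 1 := Submodule.subset_span (IsMonomial.of (.x e))
    have := E.mul_mem_component K h ih
    rwa [add_comm] at this

theorem pathY_mem_component (l : List E.Edge) (a : E.Vert) :
    E.pathY K l a ∈ E.component K (-l.length) := by
  induction l with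
  | nil => exact Submodule.subset_span (IsMonomial.of (.p a))
  | cons e l ih =>
    have h : E.gen K (.y e) ∈ E.component K (-1) := Submodule.subset_span (IsMonomial.of (.y e))
    have := E.mul_mem_component K ih h
    rwa [List.length_cons, Nat.cast_succ, neg_add]

variable {E}

/-- The product regroups as `(α* α')(β'* β)`, and one factor vanishes by orthogonality. As the
degree `n` is fixed, `α` and `α'` compare in length as `β` and `β'` do, so a strictly shorter path
on either side ends at a sink. -/
theorem pathY_mul_pathX_of_normalForms {F : Set E.Vert} {n : ℤ} {N : ℕ}
    {t t' : List E.Edge × List E.Edge × E.Vert} (ht : t ∈ E.normalForms F n N)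
    (ht' : t' ∈ E.normalForms F n N) (hne : t ≠ t') :
    E.pathY K t.1 t.2.2 * E.pathXY K t' * E.pathX K t.2.1 t.2.2 = 0 := by
  obtain ⟨α, β, a⟩ := t
  obtain ⟨α', β', a'⟩ := t'
  obtain ⟨⟨b, -, hα⟩, ⟨c, -, hβ⟩, hd, hN⟩ := ht
  obtain ⟨⟨b', -, hα'⟩, ⟨c', -, hβ'⟩, hd', hN'⟩ := ht'
  dsimp only at *
  have h1 : E.pathY K α a * E.pathXY K (α', β', a') * E.pathX K β a =
      (E.pathY K α a * E.pathX K α' a') * (E.pathY K β' a' * E.pathX K β a) := by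
    rw [pathXY]
    noncomm_ring
  rw [h1]
  have hs : β.length < β'.length → ¬ ∃ e : E.Edge, E.src e = a := fun h =>
    (hN.resolve_left (by omega)).2
  have hs' : β'.length < β.length → ¬ ∃ e : E.Edge, E.src e = a' := fun h =>
    (hN'.resolve_left (by omega)).2
  by_cases h : (α, a) = (α', a')
  · rw [pathY_mul_pathX_of_ne K hβ' hβ hs' hs, mul_zero]
    intro h'
    rw [Prod.mk.injEq] at h h'
    exact hne (by rw [h.1, h.2, h'.1])
  · rw [pathY_mul_pathX_of_ne K hα hα' (fun _ => hs (by omega)) (fun _ => hs' (by omega)) h,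
      zero_mul]

theorem pathY_mul_pathXY_mul_pathX_self {F : Set E.Vert} {n : ℤ} {N : ℕ}
    {t : List E.Edge × List E.Edge × E.Vert} (ht : t ∈ E.normalForms F n N) :
    E.pathY K t.1 t.2.2 * E.pathXY K t * E.pathX K t.2.1 t.2.2 = E.gen K (.p t.2.2) := by
  obtain ⟨⟨b, -, hα⟩, ⟨c, -, hβ⟩, -⟩ := ht
  rw [pathXY, ← mul_assoc, pathY_mul_pathX_self K hα, p_mul_pathY, pathY_mul_pathX_self K hβ]

end

end RowFiniteGraph

namespace RowFiniteGraph

section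

variable (K : Type w) [Field K] (E : RowFiniteGraph.{u, v})

/-! ### Homomorphisms out of the presented algebra -/

theorem exists_algHom_of_gen {A : Type*} [Ring A] [Algebra K A] (φ : E.Gen → A)
    (h : ∀ x y, E.AlgRel K x y → FreeAlgebra.lift K φ x = FreeAlgebra.lift K φ y) :
    ∃ f : E.UnitalAlg K →ₐ[K] A, ∀ g, f (E.unitalGen K g) = φ g := by
  refine ⟨RingQuot.liftAlgHom K ⟨FreeAlgebra.lift K φ, fun x y => h x y⟩, fun g => ?_⟩
  exact (RingQuot.liftAlgHom_mkAlgHom_apply K _ _ _).trans (FreeAlgebra.lift_ι_apply φ g)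

/-! ### The grading -/

/-- All relations are homogeneous, so tagging each generator with its degree respects them. The tag
is then a degree that can be read off any element. -/
theorem exists_grading_hom :
    ∃ δ : E.UnitalAlg K →ₐ[K] AddMonoidAlgebra (E.UnitalAlg K) ℤ,
      ∀ g, δ (E.unitalGen K g) = AddMonoidAlgebra.single (genDeg E g) (E.unitalGen K g) := by
  refine E.exists_algHom_of_gen K _ fun x y h => ?_
  have hrel := E.mkAlgHom_eq K h
  cases h with
  | p_eq_sum a ha =>
    simp only [freeGen, map_sum, map_mul, FreeAlgebra.lift_ι_apply,
      AddMonoidAlgebra.single_mul_single, genDeg] at hrel ⊢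
    rw [add_neg_cancel]
    have : E.unitalGen K (.p a) = ∑ e ∈ E.emit a, E.unitalGen K (.x e) * E.unitalGen K (.y e) :=
      hrel
    rw [this]
    exact map_sum (AddMonoidAlgebra.singleAddHom (0 : ℤ)) _ _
  | _ =>
    simp only [freeGen, map_mul, map_zero, FreeAlgebra.lift_ι_apply,
      AddMonoidAlgebra.single_mul_single, genDeg, zero_add, add_zero, neg_add_cancel] at hrel ⊢
    first
    | exact congrArg (AddMonoidAlgebra.single _) hrel
    | exact (congrArg (AddMonoidAlgebra.single _) hrel).trans (AddMonoidAlgebra.single_zero _)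

theorem iSupIndep_component : iSupIndep fun n => (E.component K n).toAddSubgroup := by
  obtain ⟨δ, hδ⟩ := E.exists_grading_hom K
  have key : ∀ (n : ℤ) (z : E.GraphAlg K), z ∈ E.component K n →
      δ z.1 = AddMonoidAlgebra.single n z.1 := by
    intro n z hz
    induction hz using Submodule.span_induction with
    | mem m hm =>
      induction hm with
      | of g => exact hδ g
      | mul _ _ h₁ h₂ =>
        rw [NonUnitalSubalgebra.coe_mul, map_mul, h₁, h₂, AddMonoidAlgebra.single_mul_single]
    | zero => simp
    | add y z _ _ hy hz =>
      rw [NonUnitalSubalgebra.coe_add, map_add, hy, hz, AddMonoidAlgebra.single_add]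
    | smul c z _ hz =>
      rw [NonUnitalSubalgebra.coe_smul, map_smul, hz, AddMonoidAlgebra.smul_single]
  -- The coefficient at `n` kills every component of another degree and is the inclusion on the
  -- component of degree `n`.
  let π : ℤ → E.GraphAlg K →+ E.UnitalAlg K := fun n =>
    { toFun := fun z => (δ z.1).coeff n
      map_zero' := by simp
      map_add' := fun y z => by simp }
  intro n
  rw [disjoint_iff_inf_le]
  rintro z ⟨hz, hz'⟩
  have h0 : ∀ y ∈ ⨆ j, ⨆ (_ : j ≠ n), (E.component K j).toAddSubgroup, y ∈ (π n).ker := by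
    have : (⨆ j, ⨆ (_ : j ≠ n), (E.component K j).toAddSubgroup) ≤ (π n).ker := by
      refine iSup₂_le fun j hj y hy => ?_
      change (δ y.1).coeff n = 0
      rw [key j y hy, AddMonoidAlgebra.coeff_single, Finsupp.single_eq_of_ne hj.symm]
    exact fun y hy => this hy
  have h1 : (δ z.1).coeff n = 0 := h0 z hz'
  rw [key n z hz, AddMonoidAlgebra.coeff_single, Finsupp.single_eq_same] at h1
  exact Subtype.ext h1

theorem iSup_component : ⨆ n, E.component K n = ⊤ := by
  rw [eq_top_iff]
  rintro ⟨z, hz⟩ -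
  induction hz using NonUnitalAlgebra.adjoin_induction with
  | mem z hz =>
    obtain ⟨g, rfl⟩ := hz
    exact Submodule.mem_iSup_of_mem (genDeg E g) (Submodule.subset_span (IsMonomial.of g))
  | zero => exact zero_mem _
  | add y z hy hz h₁ h₂ => exact add_mem h₁ h₂
  | mul y z hy hz h₁ h₂ =>
    change (⟨y, hy⟩ * ⟨z, hz⟩ : E.GraphAlg K) ∈ _
    generalize (⟨y, hy⟩ : E.GraphAlg K) = y at *
    generalize (⟨z, hz⟩ : E.GraphAlg K) = z at *
    induction h₁ using Submodule.iSup_induction' with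
    | mem m y hy =>
      induction h₂ using Submodule.iSup_induction' with
      | mem n z hz => exact Submodule.mem_iSup_of_mem (m + n) (E.mul_mem_component K hy hz)
      | zero => simp
      | add z z' _ _ h h' => rw [mul_add]; exact add_mem h h'
    | zero => simp
    | add y y' _ _ h h' => rw [add_mul]; exact add_mem h h'
  | smul c z hz h => exact Submodule.smul_mem _ c h

theorem homogeneous_induction {P : E.GraphAlg K → Prop} (z : E.GraphAlg K)
    (mem : ∀ n, ∀ z ∈ E.component K n, P z) (zero : P 0) (add : ∀ y z, P y → P z → P (y + z)) :
    P z :=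
  Submodule.iSup_induction (E.component K) (motive := P) (iSup_component K E ▸ Submodule.mem_top : z ∈ _)
    mem zero add

variable {E}

theorem iSupIndep_idealPart (I : TwoSidedIdeal (E.GraphAlg K)) : iSupIndep (E.idealPart K I) :=
  (E.iSupIndep_component K).mono fun _ => inf_le_right

theorem iSup_idealPart_le (I : TwoSidedIdeal (E.GraphAlg K)) :
    ⨆ n, E.idealPart K I n ≤ AddSubgroup.ofClass I :=
  iSup_le fun _ => inf_le_left

/-- A two-sided ideal generated by homogeneous elements is graded. -/
theorem isGradedIdeal_span {S : Set (E.GraphAlg K)} (hS : ∀ z ∈ S, ∃ n, z ∈ E.component K n) :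
    E.IsGradedIdeal K (TwoSidedIdeal.span S) := by
  set I := TwoSidedIdeal.span S with hI
  refine ⟨iSupIndep_idealPart K I, le_antisymm (iSup_idealPart_le K I) ?_⟩
  -- The sum of the homogeneous parts of `I` absorbs products because homogeneous elements span the
  -- algebra. It contains the generators, hence all of `I`.
  let G : TwoSidedIdeal (E.GraphAlg K) := TwoSidedIdeal.mk' (⨆ n, E.idealPart K I n : AddSubgroup _)
    (zero_mem _) (add_mem) (neg_mem) (by
      intro x y hy
      induction hy using AddSubgroup.iSup_induction' with
      | hp n y hy =>
        induction x using homogeneous_induction with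
        | mem m x hx =>
          exact AddSubgroup.mem_iSup_of_mem (m + n)
            ⟨I.mul_mem_left x y hy.1, E.mul_mem_component K hx hy.2⟩
        | zero => rw [zero_mul]; exact zero_mem _
        | add x x' h h' => rw [add_mul]; exact add_mem h h'
      | h1 => rw [mul_zero]; exact zero_mem _
      | hadd y y' _ _ h h' => rw [mul_add]; exact add_mem h h') (by
      intro y x hy
      induction hy using AddSubgroup.iSup_induction' with
      | hp n y hy =>
        induction x using homogeneous_induction with
        | mem m x hx =>
          exact AddSubgroup.mem_iSup_of_mem (n + m)
            ⟨I.mul_mem_right y x hy.1, E.mul_mem_component K hy.2 hx⟩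
        | zero => rw [mul_zero]; exact zero_mem _
        | add x x' h h' => rw [mul_add]; exact add_mem h h'
      | h1 => rw [zero_mul]; exact zero_mem _
      | hadd y y' _ _ h h' => rw [add_mul]; exact add_mem h h')
  have hle : I ≤ G := TwoSidedIdeal.span_le.2 fun z hz => by
    obtain ⟨n, hn⟩ := hS z hz
    rw [TwoSidedIdeal.coe_mk']
    exact AddSubgroup.mem_iSup_of_mem n ⟨TwoSidedIdeal.subset_span hz, hn⟩
  intro z hz
  have h : z ∈ (G : Set (E.GraphAlg K)) := hle (show z ∈ I from hz)
  rwa [TwoSidedIdeal.coe_mk'] at h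

/-! ### The ideals generated by vertices -/

/-- If some edges lead from `a` outside `H`, then `ℕ` is split into copies of itself indexed by
them, through a bijection of `ℕ` with `F × ℕ`. Here `τ` names the copy containing a number, `ρ` its
position there, and `κ` inverts the pair; `τ` is `none` when there are no such edges. -/
theorem exists_branching (H : Set E.Vert) (a : E.Vert) :
    ∃ (τ : ℕ → Option E.Edge) (ρ : ℕ → ℕ) (κ : E.Edge → ℕ → ℕ),
      (∀ n e, τ n = some e → E.src e = a ∧ E.rng e ∉ H ∧ κ e (ρ n) = n) ∧
      (∀ e n, E.src e = a → E.rng e ∉ H → τ (κ e n) = some e ∧ ρ (κ e n) = n) ∧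
      ((∃ e, E.src e = a ∧ E.rng e ∉ H) → ∀ n, ∃ e, τ n = some e) := by
  classical
  let F := {e : E.Edge // E.src e = a ∧ E.rng e ∉ H}
  by_cases hF : Nonempty F
  · have : Finite F :=
      ((E.finite_emit a).subset fun e he => he.1 : {e | E.src e = a ∧ E.rng e ∉ H}.Finite)
    have hcard : Nonempty (ℕ ≃ F × ℕ) := by
      obtain ⟨h⟩ := nonempty_denumerable (F × ℕ)
      exact ⟨(Denumerable.eqv (F × ℕ)).symm⟩
    obtain ⟨σ⟩ := hcard
    refine ⟨fun n => some (σ n).1.1, fun n => (σ n).2,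
      fun e n => if h : E.src e = a ∧ E.rng e ∉ H then σ.symm (⟨e, h⟩, n) else 0, ?_, ?_, ?_⟩
    · rintro n e he
      obtain rfl := Option.some.inj he
      refine ⟨(σ n).1.2.1, (σ n).1.2.2, ?_⟩
      simp only [dif_pos (σ n).1.2]
      exact σ.symm_apply_apply n
    · intro e n he he'
      simp only [dif_pos (And.intro he he'), σ.apply_symm_apply, and_self]
    · exact fun _ n => ⟨_, rfl⟩
  · refine ⟨fun _ => none, fun _ => 0, fun _ _ => 0, by simp, ?_, ?_⟩
    · exact fun e n he he' => (hF ⟨⟨e, he, he'⟩⟩).elim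
    · rintro ⟨e, he⟩
      exact (hF ⟨⟨e, he⟩⟩).elim

/-- There is a representation of the graph algebra in which exactly the vertices of a given
saturated hereditary set act as zero. -/
theorem exists_representation (H : E.SatHered) :
    ∃ f : E.UnitalAlg K →ₐ[K] Module.End K (E.Vert × ℕ → K),
      ∀ a, f (E.unitalGen K (.p a)) = 0 ↔ a ∈ H.1 := by
  classical
  choose τ ρ κ h₁ h₂ h₃ using exists_branching H.1
  have hH : ∀ e : E.Edge, E.rng e ∉ H.1 → E.src e ∉ H.1 := fun e he he' => he (H.2.1.rng_mem he')
  -- Each vertex outside `H` owns a copy of `ℕ`. There `p` is restriction to that copy, `x_e`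
  -- transports functions from the copy at the range of `e` to the piece of the copy at its source
  -- labelled `e`, and `y_e` transports them back.
  let φ : E.Gen → Module.End K (E.Vert × ℕ → K) := fun g => match g with
    | .p b =>
      { toFun := fun f s => if s.1 = b ∧ b ∉ H.1 then f s else 0
        map_add' := fun f f' => by ext s; dsimp only [Pi.add_apply]; split_ifs <;> simp
        map_smul' := fun c f => by ext s; dsimp; split_ifs <;> simp }
    | .x e =>
      { toFun := fun f s => if τ s.1 s.2 = some e then f (E.rng e, ρ s.1 s.2) else 0
        map_add' := fun f f' => by ext s; dsimp only [Pi.add_apply]; split_ifs <;> simp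
        map_smul' := fun c f => by ext s; dsimp; split_ifs <;> simp }
    | .y e =>
      { toFun := fun f s => if s.1 = E.rng e ∧ E.rng e ∉ H.1 then
          f (E.src e, κ (E.src e) e s.2) else 0
        map_add' := fun f f' => by ext s; dsimp only [Pi.add_apply]; split_ifs <;> simp
        map_smul' := fun c f => by ext s; dsimp; split_ifs <;> simp }
  have hp : ∀ b f s, φ (.p b) f s = if s.1 = b ∧ b ∉ H.1 then f s else 0 := fun _ _ _ => rfl
  have hx : ∀ e f s, φ (.x e) f s = if τ s.1 s.2 = some e then f (E.rng e, ρ s.1 s.2) else 0 :=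
    fun _ _ _ => rfl
  have hy : ∀ e f s, φ (.y e) f s = if s.1 = E.rng e ∧ E.rng e ∉ H.1 then
      f (E.src e, κ (E.src e) e s.2) else 0 := fun _ _ _ => rfl
  obtain ⟨f, hf⟩ := E.exists_algHom_of_gen K φ fun x y h => by
    cases h with
    | p_mul_self a =>
      simp only [freeGen, map_mul, FreeAlgebra.lift_ι_apply]
      ext f ⟨s, n⟩
      simp only [Module.End.mul_apply, hp]
      split_ifs <;> rfl
    | p_mul_of_ne a b hab =>
      simp only [freeGen, map_mul, map_zero, FreeAlgebra.lift_ι_apply]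
      ext f ⟨s, n⟩
      simp only [Module.End.mul_apply, hp, LinearMap.zero_apply, Pi.zero_apply]
      split_ifs with h h'
      · exact absurd (h.1.symm.trans h'.1) hab
      · rfl
      · rfl
    | p_mul_x e =>
      simp only [freeGen, map_mul, FreeAlgebra.lift_ι_apply]
      ext f ⟨s, n⟩
      simp only [Module.End.mul_apply, hp, hx]
      split_ifs with h _ h'
      · rfl
      · rfl
      · have := h₁ s n e h'
        exact absurd ⟨this.1.symm, hH e this.2.1⟩ h
      · rfl
    | x_mul_p e =>
      simp only [freeGen, map_mul, FreeAlgebra.lift_ι_apply]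
      ext f ⟨s, n⟩
      simp only [Module.End.mul_apply, hp, hx]
      split_ifs with h h'
      · rfl
      · exact absurd ⟨trivial, (h₁ s n e h).2.1⟩ h'
      · rfl
    | p_mul_y e =>
      simp only [freeGen, map_mul, FreeAlgebra.lift_ι_apply]
      ext f ⟨s, n⟩
      simp only [Module.End.mul_apply, hp, hy]
      split_ifs <;> rfl
    | y_mul_p e =>
      simp only [freeGen, map_mul, FreeAlgebra.lift_ι_apply]
      ext f ⟨s, n⟩
      simp only [Module.End.mul_apply, hp, hy]
      split_ifs with h h'
      · rfl
      · exact absurd ⟨trivial, hH e h.2⟩ h'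
      · rfl
    | y_mul_x_self e =>
      simp only [freeGen, map_mul, FreeAlgebra.lift_ι_apply]
      ext f ⟨s, n⟩
      simp only [Module.End.mul_apply, hp, hx, hy]
      split_ifs with h h'
      · rw [(h₂ _ e n rfl h.2).2, h.1]
      · exact absurd (h₂ _ e n rfl h.2).1 h'
      · rfl
    | y_mul_x_of_ne e e' hne =>
      simp only [freeGen, map_mul, map_zero, FreeAlgebra.lift_ι_apply]
      ext f ⟨s, n⟩
      simp only [Module.End.mul_apply, hx, hy, LinearMap.zero_apply, Pi.zero_apply]
      split_ifs with h h'
      · rw [(h₂ _ e n rfl h.2).1] at h'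
        exact absurd (Option.some.inj h') hne
      · rfl
      · rfl
    | p_eq_sum a ha =>
      simp only [freeGen, map_sum, map_mul, FreeAlgebra.lift_ι_apply]
      ext f ⟨s, n⟩
      simp only [LinearMap.sum_apply, Finset.sum_apply, Module.End.mul_apply, hp, hx, hy]
      split_ifs with h
      · obtain ⟨rfl, hs⟩ := h
        -- Saturation enters here: a vertex outside `H` that emits edges emits one to a vertex
        -- outside `H`, so the pieces cover its whole copy of `ℕ`.
        obtain ⟨e, he⟩ : ∃ e, τ s n = some e := by
          refine h₃ s ?_ n
          by_contra hcon
          push Not at hcon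
          exact hs (H.2.2 s ha hcon)
        obtain ⟨rfl, he₁, he₂⟩ := h₁ s n e he
        rw [Finset.sum_eq_single e, if_pos he, if_pos ⟨trivial, he₁⟩, he₂]
        · intro e' _ hne
          rw [if_neg]
          rw [he]
          exact fun h => hne (Option.some.inj h).symm
        · exact fun h => absurd (E.mem_emit.2 rfl) h
      · refine (Finset.sum_eq_zero fun e he => ?_).symm
        rw [mem_emit] at he
        subst he
        split_ifs with h' h''
        · exact absurd ⟨(h₁ s n e h').1.symm, hH e h''.2⟩ h
        · rfl
        · rfl
  refine ⟨f, fun a => ?_⟩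
  rw [hf]
  constructor
  · intro h
    by_contra ha
    have := congrFun (LinearMap.congr_fun h fun _ => 1) (a, 0)
    rw [hp, if_pos ⟨rfl, ha⟩] at this
    exact one_ne_zero this
  · intro ha
    ext f s
    rw [hp, if_neg fun h => h.2 ha]
    rfl

variable (E) in
/-- The two-sided ideal generated by the vertices in `H`. -/
noncomputable def vertIdeal (H : Set E.Vert) : TwoSidedIdeal (E.GraphAlg K) :=
  TwoSidedIdeal.span {z | ∃ a : E.Vert, a ∈ H ∧ z = E.gen K (.p a)}

/-- The representation attached to `H` vanishes on the ideal, while vertices outside `H` act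
nontrivially. This makes `H` recoverable from its ideal. -/
theorem gen_p_mem_vertIdeal (H : E.SatHered) (a : E.Vert) :
    E.gen K (.p a) ∈ E.vertIdeal K H.1 ↔ a ∈ H.1 := by
  refine ⟨fun h => ?_, fun h => TwoSidedIdeal.subset_span ⟨a, h, rfl⟩⟩
  obtain ⟨f, hf⟩ := exists_representation K H
  let f' : E.GraphAlg K →ₙₐ[K] Module.End K (E.Vert × ℕ → K) :=
    (f : E.UnitalAlg K →ₙₐ[K] _).comp (NonUnitalSubalgebraClass.subtype _)
  have hle : E.vertIdeal K H.1 ≤ TwoSidedIdeal.ker f' := by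
    refine TwoSidedIdeal.span_le.2 ?_
    rintro _ ⟨b, hb, rfl⟩
    exact (TwoSidedIdeal.mem_ker f').2 ((hf b).2 hb)
  exact (hf a).1 ((TwoSidedIdeal.mem_ker f').1 (hle h))

/-- The empty set is saturated, since saturation ignores sinks, and it generates the zero ideal. -/
theorem gen_p_ne_zero (a : E.Vert) : E.gen K (.p a) ≠ 0 := by
  have hH : E.IsHereditary ∅ ∧ E.IsSaturated ∅ := by
    refine ⟨fun _ _ _ h => h, ?_⟩
    rintro b ⟨e, he⟩ h
    exact h e he
  intro h
  have := gen_p_mem_vertIdeal K ⟨∅, hH⟩ a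
  rw [h] at this
  exact this.1 (zero_mem _)

variable (E) in
theorem isGradedIdeal_vertIdeal (H : Set E.Vert) : E.IsGradedIdeal K (E.vertIdeal K H) := by
  refine isGradedIdeal_span K ?_
  rintro _ ⟨a, -, rfl⟩
  exact ⟨0, Submodule.subset_span (IsMonomial.of (.p a))⟩

/-! ### Graded ideals recovered from their vertices -/

/-- The saturated hereditary set of the vertices lying in a two-sided ideal. -/
def vertSet (I : TwoSidedIdeal (E.GraphAlg K)) : E.SatHered :=
  ⟨{a | E.gen K (.p a) ∈ I}, by
    constructor
    · refine isHereditary_of_rng_mem fun e he => ?_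
      rw [Set.mem_ofPred_eq] at he ⊢
      rw [← gen_y_mul_x_self, ← gen_p_mul_x]
      exact I.mul_mem_left _ _ (I.mul_mem_right _ _ he)
    · intro a ha h
      rw [Set.mem_ofPred_eq, E.gen_p_eq_sum K ha]
      refine sum_mem fun e he => ?_
      rw [← gen_p_mul_y]
      exact I.mul_mem_left _ _ (I.mul_mem_right _ _ (h e (E.mem_emit.1 he)))⟩

theorem vertIdeal_vertSet_le (I : TwoSidedIdeal (E.GraphAlg K)) :
    E.vertIdeal K (vertSet K I).1 ≤ I := by
  refine TwoSidedIdeal.span_le.2 ?_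
  rintro _ ⟨a, ha, rfl⟩
  exact ha

/-- In normal form, `α* z β` equals the coefficient of `α β*` times the vertex at their common end.
Each vertex occurring with nonzero coefficient therefore lies in `I`, and the corresponding term
factors through it. -/
theorem mem_vertIdeal_of_mem_component (I : TwoSidedIdeal (E.GraphAlg K)) {n : ℤ}
    {z : E.GraphAlg K} (hz : z ∈ I) (hzn : z ∈ E.component K n) :
    z ∈ E.vertIdeal K (vertSet K I).1 := by
  obtain ⟨F, N, hF⟩ := exists_mem_normalSpan K hzn
  obtain ⟨c, hc, rfl⟩ := (Finsupp.mem_span_image_iff_linearCombination K).1 hF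
  rw [Finsupp.linearCombination_apply, Finsupp.sum] at hz ⊢
  refine sum_mem fun t ht => ?_
  have hnf := (Finsupp.mem_supported K c).1 hc
  have hcoef : c t • E.gen K (.p t.2.2) ∈ I := by
    have h := I.mul_mem_right _ (E.pathX K t.2.1 t.2.2) (I.mul_mem_left (E.pathY K t.1 t.2.2) _ hz)
    rw [Finset.mul_sum, Finset.sum_mul, Finset.sum_eq_single t] at h
    · rwa [mul_smul_comm, smul_mul_assoc, pathY_mul_pathXY_mul_pathX_self K (hnf ht)] at h
    · intro t' ht' hne
      rw [mul_smul_comm, smul_mul_assoc,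
        pathY_mul_pathX_of_normalForms K (hnf ht) (hnf ht') hne.symm, smul_zero]
    · exact fun h => absurd ht h
  have hmem : t.2.2 ∈ (vertSet K I).1 := by
    -- A two-sided ideal of a non-unital ring need not be closed under scalars, so the coefficient
    -- is cancelled by multiplying with a scaled vertex.
    have h := I.mul_mem_left ((c t)⁻¹ • E.gen K (.p t.2.2)) _ hcoef
    rwa [smul_mul_smul_comm, inv_mul_cancel₀ (Finsupp.mem_support_iff.1 ht), one_smul,
      gen_p_mul_self] at h
  have hp : E.gen K (.p t.2.2) ∈ E.vertIdeal K (vertSet K I).1 :=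
    TwoSidedIdeal.subset_span ⟨_, hmem, rfl⟩
  rw [pathXY, ← smul_mul_assoc, ← pathX_mul_p, ← smul_mul_assoc]
  exact TwoSidedIdeal.mul_mem_right _ _ _ (TwoSidedIdeal.mul_mem_left _ _ _ hp)

/-- A graded ideal is generated by the vertices it contains. -/
theorem vertIdeal_vertSet {I : TwoSidedIdeal (E.GraphAlg K)} (hI : E.IsGradedIdeal K I) :
    E.vertIdeal K (vertSet K I).1 = I := by
  refine le_antisymm (vertIdeal_vertSet_le K I) fun z hz => ?_
  have hz' : z ∈ ⨆ n, E.idealPart K I n := by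
    rw [hI.2]
    exact hz
  have hle : ⨆ n, E.idealPart K I n ≤ AddSubgroup.ofClass (E.vertIdeal K (vertSet K I).1) :=
    iSup_le fun n y hy => mem_vertIdeal_of_mem_component K I hy.1 hy.2
  exact hle hz'

theorem vertIdeal_le_iff {H H' : E.SatHered} :
    E.vertIdeal K H.1 ≤ E.vertIdeal K H'.1 ↔ H ≤ H' := by
  constructor
  · intro h a ha
    exact (gen_p_mem_vertIdeal K H' a).1 (h ((gen_p_mem_vertIdeal K H a).2 ha))
  · intro h
    refine TwoSidedIdeal.span_mono ?_
    rintro _ ⟨a, ha, rfl⟩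
    exact ⟨a, h ha, rfl⟩

variable (E) in
/-- The order-isomorphism between saturated hereditary sets and graded ideals. -/
noncomputable def gradedIdealOrderIso : E.SatHered ≃o E.GradedIdeal K where
  toFun H := ⟨E.vertIdeal K H.1, E.isGradedIdeal_vertIdeal K H.1⟩
  invFun I := vertSet K I.1
  left_inv H := Subtype.ext (Set.ext fun a => gen_p_mem_vertIdeal K H a)
  right_inv I := Subtype.ext (vertIdeal_vertSet K I.2)
  map_rel_iff' := vertIdeal_le_iff K

theorem eq_span_isIdempotentElem {I : TwoSidedIdeal (E.GraphAlg K)} (hI : E.IsGradedIdeal K I) :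
    I = TwoSidedIdeal.span {z | z ∈ I ∧ IsIdempotentElem z} := by
  refine le_antisymm ?_ (TwoSidedIdeal.span_le.2 fun z hz => hz.1)
  conv_lhs => rw [← vertIdeal_vertSet K hI]
  refine TwoSidedIdeal.span_mono ?_
  rintro _ ⟨a, ha, rfl⟩
  exact ⟨ha, E.gen_p_mul_self K a⟩

end

end RowFiniteGraph

namespace RowFiniteGraph

section

variable (K : Type w) [Field K] {E : RowFiniteGraph.{u, v}}

/-! ### The degree zero part -/

theorem pathX_mul_pathY_mem_component_zero {α β : List E.Edge} (h : α.length = β.length)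
    (a : E.Vert) : E.pathX K α a * E.pathY K β a ∈ E.component K 0 := by
  have := E.mul_mem_component K (E.pathX_mem_component K α a) (E.pathY_mem_component K β a)
  rwa [h, add_neg_cancel] at this

/-- The paths `α` with source in `F` and end `a` that occur in normal forms of degree zero. -/
def normalPaths (E : RowFiniteGraph.{u, v}) (F : Set E.Vert) (N : ℕ) :
    Set (List E.Edge × E.Vert) :=
  {t | (∃ b ∈ F, E.IsPath b t.1 t.2) ∧
    (t.1.length = N ∨ t.1.length < N ∧ ¬ ∃ e : E.Edge, E.src e = t.2)}

theorem finite_normalPaths {F : Set E.Vert} (hF : F.Finite) (N : ℕ) :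
    (E.normalPaths F N).Finite := by
  refine (hF.biUnion fun b _ => (Set.finite_le_nat N).biUnion fun n _ =>
    finite_setOf_isPath b n).subset ?_
  rintro t ⟨⟨b, hb, ht⟩, hN⟩
  refine Set.mem_biUnion hb (Set.mem_biUnion (x := t.1.length) ?_ ⟨ht, rfl⟩)
  rcases hN with h | h
  · exact h.le
  · exact h.1.le

theorem mem_normalForms_zero_iff {F : Set E.Vert} {N : ℕ} {α β : List E.Edge} {a : E.Vert} :
    (α, β, a) ∈ E.normalForms F 0 N ↔
      (α, a) ∈ E.normalPaths F N ∧ (β, a) ∈ E.normalPaths F N ∧ α.length = β.length := by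
  simp only [normalForms, normalPaths, Set.mem_ofPred_eq, add_zero, Nat.cast_inj]
  constructor
  · rintro ⟨h₁, h₂, h₃, h₄⟩
    exact ⟨⟨h₁, h₃ ▸ h₄⟩, ⟨h₂, h₄⟩, h₃⟩
  · rintro ⟨⟨h₁, -⟩, ⟨h₂, h₄⟩, h₃⟩
    exact ⟨h₁, h₂, h₃, h₄⟩

/-- Normal paths form one block for each pair of a length and an end. The length matters: paths of
different lengths may share a sink, but they never pair in degree zero. Distinct normal paths are
orthogonal, since a shorter one ends at a sink, and vertices are nonzero. -/
theorem exists_matricial_hom_range_eq_normalSpan {F : Set E.Vert} (hF : F.Finite) (N : ℕ) :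
    ∃ (d : Σ k : ℕ, Fin k → ℕ) (g : MatricialAlg K d →ₙₐ[K] E.GraphAlg K),
      Function.Injective g ∧ Set.range g = E.normalSpan K F 0 N := by
  have := (finite_normalPaths hF N).to_subtype
  obtain ⟨d, q, hq⟩ := exists_sigma_fin_equiv
    fun t : E.normalPaths F N => (t.1.1.length, t.1.2)
  have hend : ∀ j a b, (q ⟨j, a⟩).1.2 = (q ⟨j, b⟩).1.2 := fun j a b =>
    (Prod.mk.inj ((hq ⟨j, a⟩ ⟨j, b⟩).2 rfl)).2
  obtain ⟨g, hg, hgM⟩ := exists_matricial_hom K d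
    (fun s => E.pathX K (q s).1.1 (q s).1.2) (fun s => E.pathY K (q s).1.1 (q s).1.2)
    (fun s => E.gen K (.p (q s).1.2)) (fun s t hst => by
      obtain ⟨⟨b, -, hb⟩, hs⟩ := (q s).2
      obtain ⟨⟨c, -, hc⟩, ht⟩ := (q t).2
      refine pathY_mul_pathX_of_ne K hb hc (fun h => (hs.resolve_left ?_).2)
        (fun h => (ht.resolve_left ?_).2) fun h => hst (q.injective (Subtype.ext h))
      · rcases ht with ht | ht <;> omega
      · rcases hs with hs | hs <;> omega)
    (fun s => by
      obtain ⟨⟨b, -, hb⟩, -⟩ := (q s).2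
      exact pathY_mul_pathX_self K hb)
    (fun j a b => by rw [hend j b a, pathX_mul_p])
    (fun j a b => by rw [hend j b a, gen_p_mul_self]; exact gen_p_ne_zero K _)
  refine ⟨d, g, hg, Set.Subset.antisymm ?_ ?_⟩
  · rintro _ ⟨M, rfl⟩
    rw [hgM]
    refine sum_mem fun j _ => sum_mem fun a _ => sum_mem fun b _ => Submodule.smul_mem _ _ ?_
    rw [hend j a b]
    refine Submodule.subset_span ⟨((q ⟨j, a⟩).1.1, (q ⟨j, b⟩).1.1, (q ⟨j, b⟩).1.2),
      mem_normalForms_zero_iff.2 ⟨?_, (q ⟨j, b⟩).2, ?_⟩, rfl⟩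
    · rw [← hend j a b]
      exact (q ⟨j, a⟩).2
    · exact (Prod.mk.inj ((hq ⟨j, a⟩ ⟨j, b⟩).2 rfl)).1
  · have hle : E.normalSpan K F 0 N ≤ LinearMap.range (g : MatricialAlg K d →ₗ[K] E.GraphAlg K) := by
      refine Submodule.span_le.2 ?_
      rintro _ ⟨⟨α, β, a⟩, h, rfl⟩
      obtain ⟨hα, hβ, hl⟩ := mem_normalForms_zero_iff.1 h
      obtain ⟨s, hs⟩ := q.surjective ⟨_, hα⟩
      obtain ⟨t, ht⟩ := q.surjective ⟨_, hβ⟩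
      have hst : s.1 = t.1 := (hq s t).1 (by rw [hs, ht, hl])
      obtain ⟨j, s⟩ := s
      obtain ⟨j', t⟩ := t
      obtain rfl : j = j' := hst
      refine ⟨Pi.single j (Matrix.single s t 1), ?_⟩
      refine (hgM _).trans ?_
      rw [Finset.sum_eq_single j, Finset.sum_eq_single s, Finset.sum_eq_single t]
      · rw [Pi.single_eq_same, Matrix.single_apply_same, one_smul, hs, ht]
        rfl
      · intro t' _ hne
        rw [Pi.single_eq_same, Matrix.single_apply_of_ne, zero_smul]
        exact fun h => hne h.2.symm
      · simp
      · intro s' _ hne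
        refine Finset.sum_eq_zero fun t' _ => ?_
        rw [Pi.single_eq_same, Matrix.single_apply_of_ne, zero_smul]
        exact fun h => hne h.1.symm
      · simp
      · intro j' _ hne
        refine Finset.sum_eq_zero fun s' _ => Finset.sum_eq_zero fun t' _ => ?_
        rw [Pi.single_eq_of_ne hne, Matrix.zero_apply, zero_smul]
      · simp
    exact fun z hz => hle hz

/-- The spans are indexed by finite sets of sources and levels; unions and maxima make the family
directed. -/
theorem isUltramatricial_zeroPart (E : RowFiniteGraph.{u, v}) :
    IsUltramatricial K (E.zeroPart K) := by
  classical
  refine isUltramatricial_of_directed K (E.zeroPart K) (J := Finset E.Vert × ℕ)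
    (fun j => {z | z.1 ∈ E.normalSpan K j.1 0 j.2}) ?_ ?_ ?_
  · rintro ⟨F, N⟩ ⟨F', N'⟩
    refine ⟨(F ∪ F', max N N'), fun z hz => ?_, fun z hz => ?_⟩
    · exact normalSpan_mono K (by exact_mod_cast Finset.subset_union_left) 0 (le_max_left _ _) hz
    · exact normalSpan_mono K (by exact_mod_cast Finset.subset_union_right) 0 (le_max_right _ _) hz
  · rintro ⟨z, hz⟩
    obtain ⟨F, N, h⟩ := exists_mem_normalSpan K (n := 0) hz
    exact ⟨(F, N), h⟩
  · rintro ⟨F, N⟩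
    obtain ⟨d, g, hg, hrange⟩ := exists_matricial_hom_range_eq_normalSpan K F.finite_toSet N
    have hle : E.normalSpan K (F : Set E.Vert) 0 N ≤ E.component K 0 := by
      refine Submodule.span_le.2 ?_
      rintro _ ⟨⟨α, β, a⟩, h, rfl⟩
      exact pathX_mul_pathY_mem_component_zero K (mem_normalForms_zero_iff.1 h).2.2 a
    have hmem : ∀ M, g M ∈ E.zeroPart K := fun M => hle (by
      rw [← SetLike.mem_coe, ← hrange]
      exact Set.mem_range_self M)
    refine ⟨d, NonUnitalAlgHom.codRestrict g (E.zeroPart K) hmem,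
      (NonUnitalAlgHom.injective_codRestrict g _ hmem).2 hg, ?_⟩
    ext z
    have : z.1 ∈ Set.range g ↔ z.1 ∈ E.normalSpan K (F : Set E.Vert) 0 N := by
      rw [hrange, SetLike.mem_coe]
    refine Iff.trans ?_ this
    exact exists_congr fun M => Subtype.ext_iff

end

end RowFiniteGraph

theorem theorem5p3 (K : Type w) [Field K] (E : RowFiniteGraph.{u, v}) :
    (∃ (φ : E.SatHered ≃o OrderIdeal E.GraphMonoid)
        (θ : OrderIdeal E.GraphMonoid ≃o E.GradedIdeal K),
      (∀ H : E.SatHered,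
        IsLeast {I : OrderIdeal E.GraphMonoid | ∀ a ∈ H.1, E.vertClass a ∈ I.1} (φ H)) ∧
      (∀ I : OrderIdeal E.GraphMonoid,
        (φ.symm I).1 = {a : E.Vert | E.vertClass a ∈ I.1}) ∧
      (∀ I : OrderIdeal E.GraphMonoid,
        (θ I).1 = TwoSidedIdeal.span {z | ∃ a : E.Vert, E.vertClass a ∈ I.1 ∧ z = E.gen K (.p a)})) ∧
    IsUltramatricial K (E.zeroPart K) ∧
    (∀ J : TwoSidedIdeal (E.GraphAlg K), E.IsGradedIdeal K J →
      J = TwoSidedIdeal.span {z | z ∈ J ∧ IsIdempotentElem z}) := by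
  refine ⟨⟨E.satHeredOrderIso, E.satHeredOrderIso.symm.trans (E.gradedIdealOrderIso K),
    fun H => ⟨fun a ha => ?_, fun I hI => ?_⟩, fun I => rfl, fun I => rfl⟩,
    RowFiniteGraph.isUltramatricial_zeroPart K E,
    fun J hJ => RowFiniteGraph.eq_span_isIdempotentElem K hJ⟩
  · exact RowFiniteGraph.vertClass_mem_orderIdealOf.2 ha
  · exact RowFiniteGraph.orderIdealOf_le_iff.2 hI
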